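/- Let $(M,\omega)$ be a symplectic manifold (finite-dimensional, Hausdorff, second countable, without boundary; $\omega$ a smooth, closed, non-degenerate two-form). For $H\in C^\infty([0,1]\times M,\mathbb{R})$ let $X_H$ be its time-dependent Hamiltonian vector field, determined by $\omega(X_H^t,\cdot)=dH^t$ where $H^t:=H(t,\cdot)$. Let $\varphi_H^t$ be its time-$t$ flow, defined on the set $\mathcal{D}_H^t$ of all $x_0\in M$ for which there is a solution $x\in C^\infty([0,t],M)$ of $\dot x(s)=X_H^s(x(s))$, $x(0)=x_0$. For a closed subset $X\subseteq M$ let $\mathcal{H}(M,\omega,X)$ be the set of all $H\in C^\infty([0,1]\times M,\mathbb{R})$ such that $X\subseteq\mathcal{D}_H^1$ and $\varphi_H^t(X)=X$ for every $t\in[0,1]$, and put $$\mathrm{Ham}(X,\omega):=\{\varphi_H^1|_X : H\in\mathcal{H}(M,\omega,X)\},\qquad \|H\|_X:=\int_0^1\Big(\sup_X H^t-\inf_X H^t\Big)\,dt\in[0,\infty],$$ (where $\sup-\inf$ over the empty set is read as $0$), and for $\varphi\in\mathrm{Ham}(X,\omega)$ $$\|\varphi\|^{X,\omega}:=\inf\{\|H\|_X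 : H\in\mathcal{H}(M,\omega,X),\ \varphi_H^1|_X=\varphi\}.$$ For closed subsets $X\subseteq Y\subseteq M$ and $\varphi\in\mathrm{Ham}(X,\omega)$ let $$\|\varphi\|_X^{Y,\omega}:=\inf\{\|\psi\|^{Y,\omega} : \psi\in\mathrm{Ham}(Y,\omega),\ \psi|_X=\varphi\}\in[0,\infty]\qquad(\inf\emptyset:=\infty).$$ Let $X\subseteq Y$ be closed subsets of $M$. Then: 1. $\mathrm{Ham}(X,\omega)$ is a subgroup of the group of homeomorphisms of $X$, and $\|\cdot\|_X^{Y,\omega}$ is a semi-norm on it, i.e. $\|\mathrm{id}\|_X^{Y,\omega}=0$, $\|\varphi^{-1}\|_X^{Y,\omega}=\|\varphi\|_X^{Y,\omega}$ and $\|\varphi\circ\psi\|_X^{Y,\omega}\le\|\varphi\|_X^{Y,\omega}+\|\psi\|_X^{Y,\omega}$ for all $\varphi,\psi\in\mathrm{Ham}(X,\omega)$. 2. If $Y$ is compact and non-empty and $Y'\subseteq M$ is a closed subset whose interior contains $Y$, then $\|\varphi\|_X^{Y,\omega}\ge\|\varphi\|_X^{Y',\omega}$ for every $\varphi\in\mathrm{Ham}(X,\omega)$.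 -/

import Mathlib

open Set MeasureTheory
open scoped Manifold ContDiff ENNReal

namespace HoferGeometry

/-- A semi-norm on a group `G`: a map `G → [0, ∞]` which vanishes at the identity, is symmetric
under inversion and subadditive. -/
structure IsSemiNorm {G : Type*} [Group G] (N : G → ℝ≥0∞) : Prop where
  map_one : N 1 = 0
  map_inv : ∀ g : G, N g⁻¹ = N g
  map_mul_le : ∀ g h : G, N (g * h) ≤ N g + N h

section

variable {E : Type*} [NormedAddCommGroup E] [NormedSpace ℝ E]
  {M : Type*} [TopologicalSpace M] [ChartedSpace E M]

/-- The expression of a two-form `Ω` in the preferred chart around `x₀`, i.e. the pullback of `Ω`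
under the inverse of that chart (meaningful on the target of the chart). -/
noncomputable def chartForm (Ω : ∀ x : M, TangentSpace 𝓘(ℝ, E) x [⋀^Fin 2]→L[ℝ] ℝ)
    (x₀ : M) (y : E) : E [⋀^Fin 2]→L[ℝ] ℝ :=
  (Ω ((extChartAt 𝓘(ℝ, E) x₀).symm y)).compContinuousLinearMap
    (mfderiv 𝓘(ℝ, E) 𝓘(ℝ, E) (extChartAt 𝓘(ℝ, E) x₀).symm y)

variable (E M) in
/-- A symplectic form: a smooth, closed and (fibrewise) non-degenerate two-form. -/
structure SymplecticForm where
  /-- the value of the form at each point -/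
  form : ∀ x : M, TangentSpace 𝓘(ℝ, E) x [⋀^Fin 2]→L[ℝ] ℝ
  smooth : ∀ x₀ : M, ContDiffOn ℝ ∞ (chartForm form x₀) (extChartAt 𝓘(ℝ, E) x₀).target
  closed : ∀ x₀ : M, ∀ y ∈ (extChartAt 𝓘(ℝ, E) x₀).target, extDeriv (chartForm form x₀) y = 0
  nondegenerate : ∀ (x : M) (v : TangentSpace 𝓘(ℝ, E) x),
    (∀ w : TangentSpace 𝓘(ℝ, E) x, form x ![v, w] = 0) → v = 0

theorem update_snd {V : Type*} (v a b : V) : Function.update ![v, a] 1 b = ![v, b] := by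
  funext i
  fin_cases i <;> rfl

/-- The linear map `v ↦ Ω_x(v, ·)` from the tangent space at `x` to its dual. -/
noncomputable def SymplecticForm.flat (Ω : SymplecticForm E M) (x : M) :
    TangentSpace 𝓘(ℝ, E) x →ₗ[ℝ] Module.Dual ℝ (TangentSpace 𝓘(ℝ, E) x) :=
  LinearMap.mk₂ ℝ (fun v w => Ω.form x ![v, w])
    (fun v₁ v₂ w => by
      simpa using (Ω.form x).toMultilinearMap.cons_add ![w] v₁ v₂)
    (fun c v w => by
      simpa using (Ω.form x).toMultilinearMap.cons_smul ![w] c v)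
    (fun v w₁ w₂ => by
      have h := (Ω.form x).toMultilinearMap.map_update_add ![v, 0] 1 w₁ w₂
      simp only [update_snd] at h
      exact h)
    (fun c v w => by
      have h := (Ω.form x).toMultilinearMap.map_update_smul ![v, 0] 1 c w
      simp only [update_snd] at h
      exact h)

theorem SymplecticForm.flat_apply (Ω : SymplecticForm E M) (x : M)
    (v w : TangentSpace 𝓘(ℝ, E) x) : Ω.flat x v w = Ω.form x ![v, w] := rfl

theorem SymplecticForm.flat_injective (Ω : SymplecticForm E M) (x : M) :
    Function.Injective (Ω.flat x) := by
  refine (injective_iff_map_eq_zero _).2 fun v hv => Ω.nondegenerate x v fun w => ?_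
  rw [← Ω.flat_apply, hv, LinearMap.zero_apply]

instance instFiniteDimensionalTangent [FiniteDimensional ℝ E] (x : M) :
    FiniteDimensional ℝ (TangentSpace 𝓘(ℝ, E) x) :=
  inferInstanceAs (FiniteDimensional ℝ E)

/-- The isomorphism `v ↦ Ω_x(v, ·)` from the tangent space at `x` to its dual. -/
noncomputable def SymplecticForm.flatEquiv [FiniteDimensional ℝ E] (Ω : SymplecticForm E M)
    (x : M) : TangentSpace 𝓘(ℝ, E) x ≃ₗ[ℝ] Module.Dual ℝ (TangentSpace 𝓘(ℝ, E) x) :=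
  LinearMap.linearEquivOfInjective (Ω.flat x) (Ω.flat_injective x)
    Subspace.dual_finrank_eq.symm

/-- The Hamiltonian vector field `X_f` of a function `f`, determined by `Ω(X_f, ·) = df`. -/
noncomputable def hamVectorField [FiniteDimensional ℝ E] (Ω : SymplecticForm E M)
    (f : M → ℝ) (x : M) : TangentSpace 𝓘(ℝ, E) x :=
  (Ω.flatEquiv x).symm (mfderiv 𝓘(ℝ, E) 𝓘(ℝ, ℝ) f x : TangentSpace 𝓘(ℝ, E) x →L[ℝ] ℝ).toLinearMap

theorem form_hamVectorField [FiniteDimensional ℝ E] (Ω : SymplecticForm E M)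
    (f : M → ℝ) (x : M) (w : TangentSpace 𝓘(ℝ, E) x) :
    Ω.form x ![hamVectorField Ω f x, w] = (mfderiv 𝓘(ℝ, E) 𝓘(ℝ, ℝ) f x w : ℝ) := by
  have h := (Ω.flatEquiv x).apply_symm_apply
    (mfderiv 𝓘(ℝ, E) 𝓘(ℝ, ℝ) f x : TangentSpace 𝓘(ℝ, E) x →L[ℝ] ℝ).toLinearMap
  exact congrArg (fun L : Module.Dual ℝ (TangentSpace 𝓘(ℝ, E) x) => L w) h

/-- `γ` restricts to a smooth solution `[0, T] → M` of `γ'(s) = V(s, γ(s))`, where `V` is a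
time-dependent vector field. Values of `γ` outside `[0, T]` are irrelevant. -/
def IsSolution (V : ℝ → ∀ x : M, TangentSpace 𝓘(ℝ, E) x) (T : ℝ) (γ : ℝ → M) : Prop :=
  ContMDiffOn 𝓘(ℝ, ℝ) 𝓘(ℝ, E) ∞ γ (Icc 0 T) ∧
    ∀ s ∈ Icc (0 : ℝ) T, HasMFDerivWithinAt 𝓘(ℝ, ℝ) 𝓘(ℝ, E) γ (Icc 0 T) s
      ((1 : ℝ →L[ℝ] ℝ).smulRight (V s (γ s)))

/-- The domain of the time-`t` flow of `V`: all initial points `x₀` for which a solution on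
`[0, t]` starting at `x₀` exists. -/
def flowDomain (V : ℝ → ∀ x : M, TangentSpace 𝓘(ℝ, E) x) (t : ℝ) : Set M :=
  {x₀ | ∃ γ : ℝ → M, IsSolution V t γ ∧ γ 0 = x₀}

open Classical in
/-- The time-`t` flow of `V`, with the value `x₀` outside the domain of the flow. -/
noncomputable def flow (V : ℝ → ∀ x : M, TangentSpace 𝓘(ℝ, E) x) (t : ℝ) (x₀ : M) : M :=
  if h : x₀ ∈ flowDomain V t then h.choose t else x₀

/-- `V` is `X`-compatible: its flow is defined on `X` up to time one and maps `X` onto `X` at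
each time in `[0, 1]`. -/
def IsCompatible (V : ℝ → ∀ x : M, TangentSpace 𝓘(ℝ, E) x) (X : Set M) : Prop :=
  X ⊆ flowDomain V 1 ∧ ∀ t ∈ Icc (0 : ℝ) 1, flow V t '' X = X

variable (E) in
/-- `H` restricts to a smooth function on `[0, 1] × M`. Values of `H` at times outside `[0, 1]`
are irrelevant. -/
def IsSmoothHamiltonian (H : ℝ → M → ℝ) : Prop :=
  ContMDiffOn (𝓘(ℝ, ℝ).prod 𝓘(ℝ, E)) 𝓘(ℝ, ℝ) ∞ (fun p : ℝ × M => H p.1 p.2)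
    (Icc (0 : ℝ) 1 ×ˢ univ)

/-- The time-dependent Hamiltonian vector field of `H`. -/
noncomputable def hamField [FiniteDimensional ℝ E] (Ω : SymplecticForm E M)
    (H : ℝ → M → ℝ) (t : ℝ) (x : M) : TangentSpace 𝓘(ℝ, E) x :=
  hamVectorField Ω (H t) x

/-- The smooth functions on `[0, 1] × M` whose Hamiltonian vector field is `X`-compatible. -/
def compatibleHamiltonians [FiniteDimensional ℝ E] (Ω : SymplecticForm E M) (X : Set M) :
    Set (ℝ → M → ℝ) :=
  {H | IsSmoothHamiltonian E H ∧ IsCompatible (hamField Ω H) X}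

/-- `φ` is the restriction to `X` of the Hamiltonian time-one flow of `H`. -/
def IsTimeOneMap [FiniteDimensional ℝ E] (Ω : SymplecticForm E M) (X : Set M)
    (H : ℝ → M → ℝ) (φ : X → X) : Prop :=
  ∀ x : X, (φ x : M) = flow (hamField Ω H) 1 (x : M)

/-- The set `Ham(X, Ω)` of Hamiltonian diffeomorphisms of `X`, as a set of maps `X → X`. -/
def Ham [FiniteDimensional ℝ E] (Ω : SymplecticForm E M) (X : Set M) : Set (X → X) :=
  {φ | ∃ H ∈ compatibleHamiltonians Ω X, IsTimeOneMap Ω X H φ}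

/-- The oscillation `sup_X f - inf_X f ∈ [0, ∞]`, computed in the extended reals
(it is `0` if `X` is empty). -/
noncomputable def oscOn (X : Set M) (f : M → ℝ) : ℝ≥0∞ :=
  ((⨆ x ∈ X, (f x : EReal)) - ⨅ x ∈ X, (f x : EReal)).toENNReal

/-- The Hofer norm of a time-dependent function `H` on `X`. -/
noncomputable def hoferLength (X : Set M) (H : ℝ → M → ℝ) : ℝ≥0∞ :=
  ∫⁻ t in Icc (0 : ℝ) 1, oscOn X (H t)

/-- The (absolute) Hofer semi-norm of a map `φ : X → X`. -/
noncomputable def hoferNorm [FiniteDimensional ℝ E] (Ω : SymplecticForm E M) (X : Set M)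
    (φ : X → X) : ℝ≥0∞ :=
  ⨅ H ∈ {H | H ∈ compatibleHamiltonians Ω X ∧ IsTimeOneMap Ω X H φ}, hoferLength X H

/-- The Hofer semi-norm on `X` relative to `Y ⊇ X`: the infimum of the absolute Hofer semi-norms
of all elements of `Ham(Y, Ω)` that restrict to `φ` on `X`. -/
noncomputable def relHoferNorm [FiniteDimensional ℝ E] (Ω : SymplecticForm E M) {X Y : Set M}
    (hXY : X ⊆ Y) (φ : X → X) : ℝ≥0∞ :=
  ⨅ ψ ∈ {ψ | ψ ∈ Ham Ω Y ∧ ∀ x : X, ψ (inclusion hXY x) = inclusion hXY (φ x)}, hoferNorm Ω Y ψ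

end

end HoferGeometry

/-! Every algebraic operation on time-one maps is realised by a Hamiltonian built from time changes.
If `b` maps into `[0, 1]` and `γ` solves the equation of `H`, then `γ ∘ b` solves that of `b'(s)
H(b(s), x)`, and for monotone `b` running from 0 to 1 the length is unchanged by substitution.
Taking `b(s) = 1 - s` inverts the time-one map. Running two such Hamiltonians one after the other,
with steps that are flat near the junction, composes the maps and adds the lengths. Concatenation is
used instead of the formula `H + K ∘ (φ_H)⁻¹` because the flow of `H` is only controlled on `X`, not
on all of `M`. Applied to extensions on `Y`, these constructions (`isTimeOneMap_reverse`,
`isTimeOneMap_concat`) give the semi-norm axioms; applied on `X`, they give the subgroup.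

A time change by a smooth step also extends a Hamiltonian given on `[0, 1]` to all times and makes
the solutions global. Uniqueness and continuous dependence then follow from the autonomous field
`(1, V)` on `ℝ × M`. They show that time-one maps are injective and continuous.

For monotonicity, let `F` be such an extended Hamiltonian for `Y`, fix `y₀ ∈ Y`, and put `K = χ · (F
- F(t, y₀))` with a cutoff `χ` that is 1 near `Y` and supported close to `Y`, inside `Y'`. Near `Y`
the two functions differ by a function of time, so the flows agree on `Y`. The flow of `K` is
complete and fixes every point outside a compact subset of `Y'`, so it preserves `Y'`. The
normalised function takes the value 0 on `Y`, so multiplication by `χ` moves its values towards a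
value already attained there; by uniform continuity near the compact set the length grows by at most
`2ε` (`oscOn_cutoff_le`, `exists_cutoff`). -/

namespace HoferGeometry

/-! ### Smoothness of the Hamiltonian vector field -/

section FieldSmooth

open Filter Topology

variable {E : Type*} [NormedAddCommGroup E] [NormedSpace ℝ E] [FiniteDimensional ℝ E]

/-- The map `v ↦ ω(v, ·)` attached to a two-form on a finite-dimensional vector space. -/
noncomputable def twoFormFlat (η : E [⋀^Fin 2]→L[ℝ] ℝ) : E →L[ℝ] E →L[ℝ] ℝ :=
  LinearMap.toContinuousLinearMap
    ((LinearMap.toContinuousLinearMap : (E →ₗ[ℝ] ℝ) ≃ₗ[ℝ] E →L[ℝ] ℝ).toLinearMap ∘ₗ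
      LinearMap.mk₂ ℝ (fun v w => η ![v, w])
        (fun v₁ v₂ w => by simpa using η.toMultilinearMap.cons_add ![w] v₁ v₂)
        (fun c v w => by simpa using η.toMultilinearMap.cons_smul ![w] c v)
        (fun v w₁ w₂ => by
          have h := η.toMultilinearMap.map_update_add ![v, 0] 1 w₁ w₂
          simp only [update_snd] at h
          exact h)
        (fun c v w => by
          have h := η.toMultilinearMap.map_update_smul ![v, 0] 1 c w
          simp only [update_snd] at h
          exact h))

theorem twoFormFlat_apply (η : E [⋀^Fin 2]→L[ℝ] ℝ) (v w : E) :
    twoFormFlat η v w = η ![v, w] := rfl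

theorem contDiff_twoFormFlat {n : ℕ∞ω} :
    ContDiff ℝ n (twoFormFlat : (E [⋀^Fin 2]→L[ℝ] ℝ) → E →L[ℝ] E →L[ℝ] ℝ) := by
  rw [contDiff_clm_apply_iff]
  intro v
  rw [contDiff_clm_apply_iff]
  intro w
  simp only [twoFormFlat_apply]
  have h : IsBoundedLinearMap ℝ (fun η : E [⋀^Fin 2]→L[ℝ] ℝ => η ![v, w]) :=
    { map_add := fun _ _ => rfl
      map_smul := fun _ _ => rfl
      bound := ⟨‖v‖ * ‖w‖ + 1, by positivity, fun η => by
        refine (η.le_opNorm _).trans ?_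
        simp only [Fin.prod_univ_two, Matrix.cons_val_zero, Matrix.cons_val_one]
        nlinarith [norm_nonneg η]⟩ }
  exact h.contDiff

theorem isInvertible_twoFormFlat {η : E [⋀^Fin 2]→L[ℝ] ℝ}
    (h : ∀ v, (∀ w, η ![v, w] = 0) → v = 0) : (twoFormFlat η).IsInvertible := by
  have hinj : Function.Injective (twoFormFlat η).toLinearMap := by
    refine (injective_iff_map_eq_zero _).2 fun v hv => h v fun w => ?_
    rw [← twoFormFlat_apply]
    exact congrArg (fun L : E →L[ℝ] ℝ => L w) hv
  have hdim : Module.finrank ℝ E = Module.finrank ℝ (E →L[ℝ] ℝ) := by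
    rw [← (LinearMap.toContinuousLinearMap : (E →ₗ[ℝ] ℝ) ≃ₗ[ℝ] E →L[ℝ] ℝ).finrank_eq]
    exact Subspace.dual_finrank_eq.symm
  refine ⟨(LinearMap.linearEquivOfInjective _ hinj hdim).toContinuousLinearEquiv, ?_⟩
  ext v w
  rfl

variable {M : Type*} [TopologicalSpace M] [ChartedSpace E M] [IsManifold 𝓘(ℝ, E) ∞ M]

omit [FiniteDimensional ℝ E] in
theorem mfderiv_extChartAt_symm_comp {x₀ : M} {y : E}
    (hy : y ∈ (extChartAt 𝓘(ℝ, E) x₀).target) (v) :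
    mfderiv 𝓘(ℝ, E) 𝓘(ℝ, E) (extChartAt 𝓘(ℝ, E) x₀).symm y
      (mfderiv 𝓘(ℝ, E) 𝓘(ℝ, E) (extChartAt 𝓘(ℝ, E) x₀) ((extChartAt 𝓘(ℝ, E) x₀).symm y) v) = v := by
  have : IsManifold 𝓘(ℝ, E) 1 M := .of_le (n := ∞) (by simp)
  have h := mfderivWithin_extChartAt_symm_comp_mfderiv_extChartAt (I := 𝓘(ℝ, E)) hy
  rw [modelWithCornersSelf_coe, range_id, mfderivWithin_univ] at h
  exact congrArg (fun L : _ →L[ℝ] _ => L v) h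

omit [FiniteDimensional ℝ E] in
theorem mfderiv_extChartAt_comp_symm {x₀ : M} {y : E}
    (hy : y ∈ (extChartAt 𝓘(ℝ, E) x₀).target) (v) :
    mfderiv 𝓘(ℝ, E) 𝓘(ℝ, E) (extChartAt 𝓘(ℝ, E) x₀) ((extChartAt 𝓘(ℝ, E) x₀).symm y)
      (mfderiv 𝓘(ℝ, E) 𝓘(ℝ, E) (extChartAt 𝓘(ℝ, E) x₀).symm y v) = v := by
  have : IsManifold 𝓘(ℝ, E) 1 M := .of_le (n := ∞) (by simp)
  have h := mfderiv_extChartAt_comp_mfderivWithin_extChartAt_symm (I := 𝓘(ℝ, E)) hy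
  rw [modelWithCornersSelf_coe, range_id, mfderivWithin_univ] at h
  exact congrArg (fun L : _ →L[ℝ] _ => L v) h

omit [FiniteDimensional ℝ E] [IsManifold 𝓘(ℝ, E) ∞ M] in
theorem chartForm_apply (Ω : ∀ x : M, TangentSpace 𝓘(ℝ, E) x [⋀^Fin 2]→L[ℝ] ℝ) (x₀ : M) (y v w : E) :
    chartForm Ω x₀ y ![v, w] = Ω ((extChartAt 𝓘(ℝ, E) x₀).symm y)
      ![mfderiv 𝓘(ℝ, E) 𝓘(ℝ, E) (extChartAt 𝓘(ℝ, E) x₀).symm y v,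
        mfderiv 𝓘(ℝ, E) 𝓘(ℝ, E) (extChartAt 𝓘(ℝ, E) x₀).symm y w] := by
  refine congrArg (Ω ((extChartAt 𝓘(ℝ, E) x₀).symm y)) (funext fun i => ?_)
  fin_cases i <;> rfl

theorem isInvertible_flat_chartForm (Ω : SymplecticForm E M) {x₀ : M} {y : E}
    (hy : y ∈ (extChartAt 𝓘(ℝ, E) x₀).target) :
    (twoFormFlat (chartForm Ω.form x₀ y)).IsInvertible := by
  refine isInvertible_twoFormFlat fun v hv => ?_
  have h0 : mfderiv 𝓘(ℝ, E) 𝓘(ℝ, E) (extChartAt 𝓘(ℝ, E) x₀).symm y v = 0 := by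
    refine Ω.nondegenerate _ _ fun w => ?_
    have h := (chartForm_apply Ω.form x₀ y v _).symm.trans
      (hv (mfderiv 𝓘(ℝ, E) 𝓘(ℝ, E) (extChartAt 𝓘(ℝ, E) x₀) ((extChartAt 𝓘(ℝ, E) x₀).symm y) w))
    rw [mfderiv_extChartAt_symm_comp hy] at h
    exact h
  have := mfderiv_extChartAt_comp_symm hy v
  rw [h0, map_zero] at this
  exact this.symm

/-- Read in the chart, `ω(X_f, ·) = df` is a linear equation with invertible coefficient. Solving it
by operator inversion reduces smoothness of `X_f` to smoothness of inversion. -/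
theorem mfderiv_extChartAt_hamVectorField (Ω : SymplecticForm E M) {f : M → ℝ} {x₀ : M} {y : E}
    (hy : y ∈ (extChartAt 𝓘(ℝ, E) x₀).target)
    (hf : MDifferentiableAt 𝓘(ℝ, E) 𝓘(ℝ, ℝ) f ((extChartAt 𝓘(ℝ, E) x₀).symm y)) :
    mfderiv 𝓘(ℝ, E) 𝓘(ℝ, E) (extChartAt 𝓘(ℝ, E) x₀) ((extChartAt 𝓘(ℝ, E) x₀).symm y)
      (hamVectorField Ω f ((extChartAt 𝓘(ℝ, E) x₀).symm y)) =
    (twoFormFlat (chartForm Ω.form x₀ y)).inverse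
      (fderiv ℝ (fun z => f ((extChartAt 𝓘(ℝ, E) x₀).symm z)) y) := by
  have : IsManifold 𝓘(ℝ, E) 1 M := .of_le (n := ∞) (by simp)
  obtain ⟨e, he⟩ := isInvertible_flat_chartForm Ω hy
  have hs : MDifferentiableAt 𝓘(ℝ, E) 𝓘(ℝ, E) (extChartAt 𝓘(ℝ, E) x₀).symm y := by
    have := mdifferentiableWithinAt_extChartAt_symm (I := 𝓘(ℝ, E)) hy
    rwa [modelWithCornersSelf_coe, range_id, mdifferentiableWithinAt_univ] at this
  let v : E := mfderiv 𝓘(ℝ, E) 𝓘(ℝ, E) (extChartAt 𝓘(ℝ, E) x₀) ((extChartAt 𝓘(ℝ, E) x₀).symm y)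
    (hamVectorField Ω f ((extChartAt 𝓘(ℝ, E) x₀).symm y))
  have key : twoFormFlat (chartForm Ω.form x₀ y) v =
      fderiv ℝ (fun z => f ((extChartAt 𝓘(ℝ, E) x₀).symm z)) y := by
    ext u
    rw [twoFormFlat_apply, chartForm_apply, mfderiv_extChartAt_symm_comp hy, form_hamVectorField]
    have := mfderiv_comp (I := 𝓘(ℝ, E)) (I' := 𝓘(ℝ, E)) (I'' := 𝓘(ℝ, ℝ)) y hf hs
    rw [← mfderiv_eq_fderiv]
    exact (DFunLike.congr_fun this u).symm
  have hv : (twoFormFlat (chartForm Ω.form x₀ y)).inverse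
      (twoFormFlat (chartForm Ω.form x₀ y) v) = v := by
    rw [← he, ContinuousLinearMap.inverse_equiv]
    exact e.symm_apply_apply v
  rw [key] at hv
  exact hv.symm

/-- The time-dependent Hamiltonian vector field of a smooth function on `ℝ × M` is smooth. -/
theorem contMDiff_hamField (Ω : SymplecticForm E M) {H : ℝ → M → ℝ}
    (hH : ContMDiff (𝓘(ℝ, ℝ).prod 𝓘(ℝ, E)) 𝓘(ℝ, ℝ) ∞ (fun p : ℝ × M => H p.1 p.2)) :
    ContMDiff (𝓘(ℝ, ℝ).prod 𝓘(ℝ, E)) 𝓘(ℝ, E).tangent ∞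
      (fun p : ℝ × M => (⟨p.2, hamField Ω H p.1 p.2⟩ : TangentBundle 𝓘(ℝ, E) M)) := by
  have : IsManifold 𝓘(ℝ, E) 1 M := .of_le (n := ∞) (by simp)
  rintro ⟨t₀, x₀⟩
  rw [Bundle.contMDiffAt_totalSpace]
  refine ⟨contMDiffAt_snd, ?_⟩
  set φ := extChartAt 𝓘(ℝ, E) x₀ with hφ
  have hslice (t : ℝ) : ContMDiff 𝓘(ℝ, E) 𝓘(ℝ, ℝ) ∞ (H t) :=
    hH.comp (contMDiff_const.prodMk contMDiff_id)
  let h : ℝ × E → ℝ := fun q => H q.1 (φ.symm q.2)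
  have hh : ContDiffOn ℝ ∞ h (univ ×ˢ φ.target) := by
    have h1 : ContMDiffOn (𝓘(ℝ, ℝ).prod 𝓘(ℝ, E)) (𝓘(ℝ, ℝ).prod 𝓘(ℝ, E)) ∞
        (fun q : ℝ × E => (q.1, φ.symm q.2)) (univ ×ˢ φ.target) :=
      contMDiffOn_fst.prodMk
        ((contMDiffOn_extChartAt_symm x₀).comp contMDiffOn_snd fun q hq => hq.2)
    have h2 := hH.comp_contMDiffOn h1
    rw [← contMDiffOn_iff_contDiffOn, modelWithCornersSelf_prod, ← chartedSpaceSelf_prod]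
    exact h2
  have hopen : IsOpen ((univ : Set ℝ) ×ˢ φ.target) :=
    isOpen_univ.prod (isOpen_extChartAt_target x₀)
  let F : ℝ × E → E := fun q => (twoFormFlat (chartForm Ω.form x₀ q.2)).inverse
    (fderiv ℝ (fun z => h (q.1, z)) q.2)
  have hF : ∀ q ∈ (univ : Set ℝ) ×ˢ φ.target, ContDiffAt ℝ ∞ F q := by
    intro q hq
    have hω : ContDiffAt ℝ ∞ (fun q : ℝ × E => twoFormFlat (chartForm Ω.form x₀ q.2)) q :=
      contDiff_twoFormFlat.contDiffAt.comp q
        ((((Ω.smooth x₀).contDiffAt ((isOpen_extChartAt_target x₀).mem_nhds hq.2))).comp q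
          contDiffAt_snd)
    have hinv : ContDiffAt ℝ ∞
        (fun q : ℝ × E => (twoFormFlat (chartForm Ω.form x₀ q.2)).inverse) q :=
      ContDiffAt.comp (g := ContinuousLinearMap.inverse) q
        (isInvertible_flat_chartForm Ω hq.2).contDiffAt_map_inverse hω
    refine hinv.clm_apply ?_
    have hc : ContDiffAt ℝ ∞ (Function.uncurry fun (p : ℝ × E) (z : E) => h (p.1, z)) (q, q.2) := by
      have h1 : ContDiffAt ℝ ∞ h ((fun r : (ℝ × E) × E => (r.1.1, r.2)) (q, q.2)) :=
        hh.contDiffAt (hopen.mem_nhds hq)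
      exact h1.comp (q, q.2) (f := fun r : (ℝ × E) × E => (r.1.1, r.2)) (by fun_prop)
    exact ContDiffAt.fderiv hc contDiffAt_snd le_rfl
  have hmem : ((univ : Set ℝ) ×ˢ φ.source) ∈ 𝓝 (t₀, x₀) :=
    (isOpen_univ.prod (isOpen_extChartAt_source x₀)).mem_nhds ⟨mem_univ _, mem_extChartAt_source x₀⟩
  have hcomp : ContMDiffAt (𝓘(ℝ, ℝ).prod 𝓘(ℝ, E)) 𝓘(ℝ, E) ∞
      (fun p : ℝ × M => F (p.1, φ p.2)) (t₀, x₀) := by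
    have h1 : ContMDiffAt (𝓘(ℝ, ℝ).prod 𝓘(ℝ, E)) 𝓘(ℝ, E) ∞ F (t₀, φ x₀) := by
      have := (hF (t₀, φ x₀) ⟨mem_univ _, mem_extChartAt_target x₀⟩).contMDiffAt
      rwa [modelWithCornersSelf_prod, ← chartedSpaceSelf_prod] at this
    exact h1.comp (t₀, x₀) (f := fun p : ℝ × M => (p.1, φ p.2))
      (contMDiffAt_fst.prodMk ((contMDiffAt_extChartAt).comp (t₀, x₀) contMDiffAt_snd))
  refine hcomp.congr_of_eventuallyEq ?_
  filter_upwards [hmem] with p hp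
  have hx : p.2 ∈ (chartAt E x₀).source := by simpa [hφ] using hp.2
  have hinv : φ.symm (φ p.2) = p.2 := φ.left_inv hp.2
  have h1 := mfderiv_extChartAt_hamVectorField Ω (f := H p.1) (φ.map_source hp.2)
    ((hslice p.1).mdifferentiableAt (by simp))
  rw [← hφ, hinv] at h1
  -- The trivialization of the tangent bundle at `x₀` is the derivative of the chart, so the fibre
  -- coordinate of the field is the expression computed in `h1`.
  have h2 := TangentBundle.continuousLinearMapAt_trivializationAt (I := 𝓘(ℝ, E)) hx
  have h3 := congrArg (fun L : _ →L[ℝ] _ => L (hamField Ω H p.1 p.2)) h2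
  refine Eq.trans ?_ (h3.trans h1)
  rw [Bundle.Trivialization.continuousLinearMapAt_apply, Bundle.Trivialization.coe_linearMapAt_of_mem]
  simpa using hx

end FieldSmooth

/-! ### Integral curves of autonomous fields: local flow, continuous dependence, regularity -/

section IntegralCurves

open Filter Topology Function

variable {E : Type*} [NormedAddCommGroup E] [NormedSpace ℝ E]
  {B : Type*} [TopologicalSpace B] {I : ModelWithCorners ℝ E B}
  {N : Type*} [TopologicalSpace N] [ChartedSpace B N] [IsManifold I 1 N]
  {v : (x : N) → TangentSpace I x}

variable (v) in
/-- The expression of a vector field in the preferred chart around `x₀`. -/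
noncomputable def chartField (x₀ : N) (y : E) : E :=
  tangentCoordChange I ((extChartAt I x₀).symm y) x₀ ((extChartAt I x₀).symm y)
    (v ((extChartAt I x₀).symm y))

theorem contDiffAt_chartField [I.Boundaryless] {n : ℕ∞ω} {x₀ : N}
    (hv : ContMDiffAt I I.tangent n (fun x => (⟨x, v x⟩ : TangentBundle I N)) x₀) :
    ContDiffAt ℝ n (chartField v x₀) (extChartAt I x₀ x₀) := by
  rw [contMDiffAt_iff] at hv
  exact (hv.2.contDiffAt
    (range_mem_nhds_isInteriorPoint BoundarylessManifold.isInteriorPoint)).snd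

/-- The manifold derivative at `t` is read in the chart centred at the moving point, whereas `f`
lives in the chart at `x₀`. The two coordinate changes cancel. -/
theorem hasMFDerivAt_extChartAt_symm_comp [I.Boundaryless] {x₀ : N} {f : ℝ → E} {t : ℝ}
    (ht : f t ∈ (extChartAt I x₀).target) (hf : HasDerivAt f (chartField v x₀ (f t)) t) :
    HasMFDerivAt 𝓘(ℝ, ℝ) I ((extChartAt I x₀).symm ∘ f) t
      ((1 : ℝ →L[ℝ] ℝ).smulRight (v ((extChartAt I x₀).symm (f t)))) := by
  let xₜ : N := (extChartAt I x₀).symm (f t)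
  have h : HasDerivAt f (x := t) (tangentCoordChange I xₜ x₀ xₜ (v xₜ)) := hf
  have hft1 := (extChartAt I x₀).target_subset_preimage_source ht
  have hft2 := mem_extChartAt_source (I := I) xₜ
  let w : E := v xₜ
  have hw : tangentCoordChange I x₀ xₜ xₜ (tangentCoordChange I xₜ x₀ xₜ w) = w :=
    (tangentCoordChange_comp ⟨⟨hft2, hft1⟩, hft2⟩).trans (tangentCoordChange_self hft2)
  have hd : HasFDerivAt (extChartAt I xₜ ∘ (extChartAt I x₀).symm)
      (tangentCoordChange I x₀ xₜ xₜ) (f t) := by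
    apply HasFDerivWithinAt.hasFDerivAt (s := range I) _ <|
      mem_of_superset ((isOpen_extChartAt_target x₀).mem_nhds ht)
        (extChartAt_target_subset_range x₀)
    rw [← (extChartAt I x₀).right_inv ht]
    exact hasFDerivWithinAt_tangentCoordChange ⟨hft1, hft2⟩
  have key : HasDerivAt ((extChartAt I xₜ ∘ (extChartAt I x₀).symm) ∘ f) w t :=
    (hd.comp_hasDerivAt t h).congr_deriv hw
  exact ⟨(continuousAt_extChartAt_symm'' ht).comp h.continuousAt,
    key.hasFDerivAt.hasFDerivWithinAt⟩

/-- A `C¹` vector field on a boundaryless manifold has a continuous local flow. -/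
theorem exists_localFlow [CompleteSpace E] [I.Boundaryless] {p : N}
    (hv : ContMDiffAt I I.tangent 1 (fun x => (⟨x, v x⟩ : TangentBundle I N)) p) :
    ∃ W ∈ 𝓝 p, ∃ ε > (0 : ℝ), ∃ Φ : N → ℝ → N,
      (∀ q ∈ W, Φ q 0 = q ∧ IsMIntegralCurveOn (Φ q) v (Ioo (-ε) ε)) ∧
      ∀ s ∈ Ioo (-ε) ε, ContinuousOn (fun q => Φ q s) W := by
  obtain ⟨ε, hε, a, r, L, K, hr, hpl⟩ :=
    IsPicardLindelof.of_contDiffAt_one (contDiffAt_chartField hv)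
  obtain ⟨α, hα, hαc⟩ := (hpl 0).exists_forall_mem_closedBall_eq_hasDerivWithinAt_continuousOn
  simp only [zero_sub, zero_add] at hα hαc
  set y₀ := extChartAt I p p
  have hr' : (0 : ℝ) < r := hr
  have hy₀ : y₀ ∈ Metric.closedBall y₀ (r : ℝ) := Metric.mem_closedBall_self hr'.le
  have hα0 : α (y₀, 0) = y₀ := (hα y₀ hy₀).1
  have hnhds : Metric.closedBall y₀ (r : ℝ) ×ˢ Icc (-ε) ε ∈ 𝓝 (y₀, (0 : ℝ)) :=
    prod_mem_nhds (Metric.closedBall_mem_nhds _ hr') (Icc_mem_nhds (by linarith) hε)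
  have hmem : ∀ᶠ q in 𝓝 (y₀, (0 : ℝ)), α q ∈ (extChartAt I p).target :=
    (hαc.continuousAt hnhds).eventually_mem
      (by rw [hα0]; exact (isOpen_extChartAt_target p).mem_nhds (mem_extChartAt_target p))
  -- Initial values and times are shrunk together so that the flow in `E` never leaves the chart
  -- target and can be carried back to the manifold.
  obtain ⟨U, hU, J, hJ, hUJ⟩ := mem_nhds_prod_iff.1 (Filter.inter_mem hmem hnhds)
  obtain ⟨δ, hδ, hδJ⟩ := Metric.mem_nhds_iff.1 hJ
  rw [Real.ball_eq_Ioo, zero_sub, zero_add] at hδJ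
  have hUJ' : ∀ y ∈ U, ∀ s ∈ Ioo (-δ) δ, α (y, s) ∈ (extChartAt I p).target ∧
      y ∈ Metric.closedBall y₀ (r : ℝ) ∧ s ∈ Icc (-ε) ε :=
    fun y hy s hs => hUJ (mk_mem_prod hy (hδJ hs))
  refine ⟨(extChartAt I p).source ∩ extChartAt I p ⁻¹' U,
    Filter.inter_mem (extChartAt_source_mem_nhds p) ((continuousAt_extChartAt p) hU),
    min δ ε, lt_min hδ hε, fun q s => (extChartAt I p).symm (α (extChartAt I p q, s)), ?_, ?_⟩
  · rintro q ⟨hq, hqU⟩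
    have h0 := hUJ' _ hqU 0 ⟨by linarith, hδ⟩
    refine ⟨?_, fun s hs => ?_⟩
    · beta_reduce
      rw [(hα _ h0.2.1).1, (extChartAt I p).left_inv hq]
    · have hsε : s ∈ Ioo (-ε) ε :=
        ⟨(neg_le_neg (min_le_right δ ε)).trans_lt hs.1, hs.2.trans_le (min_le_right δ ε)⟩
      have hsδ : s ∈ Ioo (-δ) δ :=
        ⟨(neg_le_neg (min_le_left δ ε)).trans_lt hs.1, hs.2.trans_le (min_le_left δ ε)⟩
      exact (hasMFDerivAt_extChartAt_symm_comp (f := fun s => α (extChartAt I p q, s))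
        (hUJ' _ hqU s hsδ).1 (((hα _ h0.2.1).2 s (Ioo_subset_Icc_self hsε)).hasDerivAt
          (Icc_mem_nhds hsε.1 hsε.2))).hasMFDerivWithinAt
  · intro s hs
    have hsδ : s ∈ Ioo (-δ) δ :=
      ⟨(neg_le_neg (min_le_left δ ε)).trans_lt hs.1, hs.2.trans_le (min_le_left δ ε)⟩
    refine (continuousOn_extChartAt_symm p).comp (hαc.comp (((continuousOn_extChartAt p).mono
      inter_subset_left).prodMk continuousOn_const) ?_) ?_
    · exact fun q hq => (hUJ' _ hq.2 s hsδ).2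
    · exact fun q hq => (hUJ' _ hq.2 s hsδ).1

/-- Continuous dependence of global integral curves on the initial value. -/
theorem tendsto_integralCurve [CompleteSpace E] [I.Boundaryless] [T2Space N]
    (hv : ContMDiff I I.tangent 1 (fun x => (⟨x, v x⟩ : TangentBundle I N)))
    {ι : Type*} {l : Filter ι} {F : ι → ℝ → N} {c : ℝ → N}
    (hF : ∀ i, IsMIntegralCurve (F i) v) (hc : IsMIntegralCurve c v) {t₀ : ℝ}
    (h0 : Tendsto (fun i => F i t₀) l (𝓝 (c t₀))) (t : ℝ) :
    Tendsto (fun i => F i t) l (𝓝 (c t)) := by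
  let S : Set ℝ := {t | Tendsto (fun i => F i t) l (𝓝 (c t))}
  -- Convergence at one time near `t₀` spreads to all times near `t₀`, with `δ` independent of the
  -- pair. This makes `S` both open and closed.
  have hloc : ∀ t₀ : ℝ, ∃ δ > 0, ∀ t₁ ∈ Metric.ball t₀ δ, ∀ t₂ ∈ Metric.ball t₀ δ,
      t₁ ∈ S → t₂ ∈ S := by
    intro t₀
    obtain ⟨W, hW, ε, hε, Φ, hΦ, hΦc⟩ := exists_localFlow (hv (c t₀))
    obtain ⟨δ, hδ, hδW⟩ := Metric.mem_nhds_iff.1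
      (hc.continuous.continuousAt.preimage_mem_nhds (interior_mem_nhds.2 hW))
    have huniq {γ : ℝ → N} (hγ : IsMIntegralCurve γ v) {t₁ s : ℝ} (hs : s ∈ Ioo (-ε) ε)
        (h1 : γ t₁ ∈ W) : Φ (γ t₁) s = γ (s + t₁) :=
      isMIntegralCurveOn_Ioo_eqOn_of_contMDiff_boundaryless (t₀ := 0) ⟨by linarith, hε⟩ hv
        (hΦ _ h1).2 ((hγ.comp_add t₁).isMIntegralCurveOn _)
        (by rw [(hΦ _ h1).1, comp_apply, zero_add]) hs
    refine ⟨min δ (ε / 2), lt_min hδ (by linarith), fun t₁ ht₁ t₂ ht₂ h1 => ?_⟩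
    have hs : t₂ - t₁ ∈ Ioo (-ε) ε := by
      rw [Metric.mem_ball, Real.dist_eq, lt_min_iff] at ht₁ ht₂
      have h1 := abs_lt.1 ht₁.2
      have h2 := abs_lt.1 ht₂.2
      constructor <;> linarith
    have hct₁ : c t₁ ∈ interior W := hδW (Metric.ball_subset_ball (min_le_left _ _) ht₁)
    have hev : ∀ᶠ i in l, F i t₁ ∈ W :=
      (h1.eventually_mem (isOpen_interior.mem_nhds hct₁)).mono fun i hi => interior_subset hi
    have hlim : Tendsto (fun i => Φ (F i t₁) (t₂ - t₁)) l (𝓝 (Φ (c t₁) (t₂ - t₁))) :=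
      Tendsto.comp ((hΦc _ hs).continuousAt (mem_interior_iff_mem_nhds.1 hct₁)) h1
    rw [huniq hc hs (interior_subset hct₁), sub_add_cancel] at hlim
    refine hlim.congr' ?_
    filter_upwards [hev] with i hi
    rw [huniq (hF i) hs hi, sub_add_cancel]
  have hclopen : IsClopen S := by
    constructor
    · refine isClosed_of_closure_subset fun t ht => ?_
      obtain ⟨δ, hδ, h⟩ := hloc t
      obtain ⟨t₁, ht₁, hd⟩ := Metric.mem_closure_iff.1 ht δ hδ
      exact h t₁ (by rwa [Metric.mem_ball, dist_comm]) t (Metric.mem_ball_self hδ) ht₁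
    · refine Metric.isOpen_iff.2 fun t ht => ?_
      obtain ⟨δ, hδ, h⟩ := hloc t
      exact ⟨δ, hδ, fun t₁ ht₁ => h t (Metric.mem_ball_self hδ) t₁ ht₁ ht⟩
  have huniv : S = univ := hclopen.eq_univ ⟨t₀, h0⟩
  exact (huniv.symm ▸ mem_univ t : t ∈ S)

/-- Integral curves of a `C^n` vector field are `C^n`. -/
theorem contMDiff_integralCurve_nat [CompleteSpace E] [I.Boundaryless] {n : ℕ}
    (hv : ContMDiff I I.tangent n (fun x => (⟨x, v x⟩ : TangentBundle I N)))
    {γ : ℝ → N} (hγ : IsMIntegralCurve γ v) : ContMDiff 𝓘(ℝ, ℝ) I n γ := by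
  intro t₀
  rw [contMDiffAt_iff_target]
  refine ⟨hγ.continuous.continuousAt, ?_⟩
  rw [contMDiffAt_iff_contDiffAt]
  -- For finite `n`, being `C^n` at a point gives `C^n` on a whole neighbourhood; the smooth case is
  -- assembled from all finite `n`.
  obtain ⟨U, hU, hUn⟩ := (contDiffAt_chartField (hv (γ t₀))).contDiffOn (m := n) le_rfl (by simp)
  have hcont : ContinuousAt (extChartAt I (γ t₀) ∘ γ) t₀ :=
    (continuousAt_extChartAt _).comp hγ.continuous.continuousAt
  have hev : ∀ᶠ t in 𝓝 t₀, HasDerivAt (extChartAt I (γ t₀) ∘ γ)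
      (chartField v (γ t₀) ((extChartAt I (γ t₀) ∘ γ) t)) t ∧ (extChartAt I (γ t₀) ∘ γ) t ∈ U := by
    filter_upwards [(hγ.isMIntegralCurveAt t₀).eventually_hasDerivAt, hcont.preimage_mem_nhds hU,
      hγ.continuous.continuousAt.preimage_mem_nhds (extChartAt_source_mem_nhds (I := I) (γ t₀))]
      with t h1 h2 h3
    refine ⟨?_, h2⟩
    rw [chartField, comp_apply, (extChartAt I (γ t₀)).left_inv h3]
    exact h1
  obtain ⟨δ, hδ, h⟩ := Metric.nhds_basis_closedBall.eventually_iff.1 hev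
  rw [Real.closedBall_eq_Icc] at h
  have key := ODE.contDiffOn_enat_Icc_of_hasDerivWithinAt (n := n) (u := U)
    (f := fun _ => chartField v (γ t₀)) (α := extChartAt I (γ t₀) ∘ γ)
    (tmin := t₀ - δ) (tmax := t₀ + δ)
    (hUn.comp contDiffOn_snd fun q hq => hq.2)
    (fun t ht => (h ht).1.hasDerivWithinAt) (fun t ht => (h ht).2)
  exact key.contDiffAt (Icc_mem_nhds (by linarith) (by linarith))

/-- Integral curves of a smooth vector field are smooth. -/
theorem contMDiff_integralCurve [CompleteSpace E] [I.Boundaryless]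
    (hv : ContMDiff I I.tangent ∞ (fun x => (⟨x, v x⟩ : TangentBundle I N)))
    {γ : ℝ → N} (hγ : IsMIntegralCurve γ v) : ContMDiff 𝓘(ℝ, ℝ) I ∞ γ :=
  contMDiff_infty.2 fun n => contMDiff_integralCurve_nat (hv.of_le (by exact_mod_cast le_top)) hγ

end IntegralCurves

/-! ### Time-dependent fields via the suspension on `ℝ × M` -/

section Trajectories

open Filter Topology Function

variable {E : Type*} [NormedAddCommGroup E] [NormedSpace ℝ E]
  {M : Type*} [TopologicalSpace M] [ChartedSpace E M]
  {V : ℝ → ∀ x : M, TangentSpace 𝓘(ℝ, E) x}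

/-- A global trajectory of a time-dependent vector field. -/
def IsTrajectory (V : ℝ → ∀ x : M, TangentSpace 𝓘(ℝ, E) x) (c : ℝ → M) : Prop :=
  ∀ s, HasMFDerivAt 𝓘(ℝ, ℝ) 𝓘(ℝ, E) c s ((1 : ℝ →L[ℝ] ℝ).smulRight (V s (c s)))

/-- The suspension `(1, V)` of a time-dependent vector field on `M`, a vector field on `ℝ × M`. -/
def suspend (V : ℝ → ∀ x : M, TangentSpace 𝓘(ℝ, E) x) (p : ℝ × M) :
    TangentSpace (𝓘(ℝ, ℝ).prod 𝓘(ℝ, E)) p :=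
  ((1 : ℝ), V p.1 p.2)

/-- The shift `τ` is the initial clock time: it is 0 for trajectories, and arbitrary for the
stationary curves in `exists_isTrajectory`. -/
theorem hasMFDerivAt_suspend {c : ℝ → M} {s τ : ℝ}
    (hc : HasMFDerivAt 𝓘(ℝ, ℝ) 𝓘(ℝ, E) c s ((1 : ℝ →L[ℝ] ℝ).smulRight (V (s + τ) (c s)))) :
    HasMFDerivAt 𝓘(ℝ, ℝ) (𝓘(ℝ, ℝ).prod 𝓘(ℝ, E)) (fun s => (s + τ, c s)) s
      ((1 : ℝ →L[ℝ] ℝ).smulRight (suspend V (s + τ, c s))) := by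
  have h1 : HasMFDerivAt 𝓘(ℝ, ℝ) 𝓘(ℝ, ℝ) (fun s : ℝ => s + τ) s (1 : ℝ →L[ℝ] ℝ) :=
    ((hasFDerivAt_id s).add_const τ).hasMFDerivAt
  have h2 := h1.prodMk hc
  refine h2.congr_mfderiv (ContinuousLinearMap.ext fun r => Prod.ext ?_ rfl)
  exact (mul_one (M := ℝ) r).symm

theorem IsTrajectory.isMIntegralCurve {c : ℝ → M} (hc : IsTrajectory V c) :
    IsMIntegralCurve (fun s => (s + 0, c s)) (suspend V) := fun s =>
  hasMFDerivAt_suspend (by rw [add_zero]; exact hc s)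

theorem fst_isMIntegralCurve {γ : ℝ → ℝ × M} (hγ : IsMIntegralCurve γ (suspend V)) (s : ℝ) :
    (γ s).1 = (γ 0).1 + s := by
  have h : ∀ s, HasDerivAt (fun s => (γ s).1 - s) 0 s := fun s => by
    have h1 := (hasMFDerivAt_fst (I := 𝓘(ℝ, ℝ)) (I' := 𝓘(ℝ, E)) (γ s)).comp s (hγ s)
    have h2 : HasFDerivAt (fun s => (γ s).1) (1 : ℝ →L[ℝ] ℝ) s :=
      hasMFDerivAt_iff_hasFDerivAt.1
        (h1.congr_mfderiv (ContinuousLinearMap.ext fun r => mul_one (M := ℝ) r))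
    have h3 : HasDerivAt (fun s => (γ s).1) 1 s := h2.hasDerivAt
    convert! h3.sub (hasDerivAt_id s) using 1
    rw [sub_self]
  have := is_const_of_deriv_eq_zero (fun s => (h s).differentiableAt) (fun s => (h s).deriv) s 0
  linarith

/-- The first component of `γ` is a clock running at unit speed; the shift makes it show the time
`s`. -/
theorem isTrajectory_of_isMIntegralCurve {γ : ℝ → ℝ × M} (hγ : IsMIntegralCurve γ (suspend V)) :
    IsTrajectory V (fun s => (γ (s - (γ 0).1)).2) := fun s => by
  have h1 := (hasMFDerivAt_snd (I := 𝓘(ℝ, ℝ)) (I' := 𝓘(ℝ, E)) (γ (s - (γ 0).1))).comp _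
    (hγ (s - (γ 0).1))
  have h2 : HasMFDerivAt 𝓘(ℝ, ℝ) 𝓘(ℝ, ℝ) (fun s : ℝ => s - (γ 0).1) s (1 : ℝ →L[ℝ] ℝ) :=
    ((hasFDerivAt_id s).sub_const (γ 0).1).hasMFDerivAt
  have h3 := h1.comp s h2
  have h4 : (γ (s - (γ 0).1)).1 = s := by rw [fst_isMIntegralCurve hγ]; ring
  have h5 : V (γ (s - (γ 0).1)).1 (γ (s - (γ 0).1)).2 = V s (γ (s - (γ 0).1)).2 := by rw [h4]
  rw [← h5]
  exact h3

variable [IsManifold 𝓘(ℝ, E) ∞ M]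

/-- Smoothness of a time-dependent vector field, as a map `ℝ × M → TM`. -/
def IsSmoothField (V : ℝ → ∀ x : M, TangentSpace 𝓘(ℝ, E) x) : Prop :=
  ContMDiff (𝓘(ℝ, ℝ).prod 𝓘(ℝ, E)) 𝓘(ℝ, E).tangent ∞
    (fun p : ℝ × M => (⟨p.2, V p.1 p.2⟩ : TangentBundle 𝓘(ℝ, E) M))

theorem IsSmoothField.contMDiff_suspend (hV : IsSmoothField V) :
    ContMDiff (𝓘(ℝ, ℝ).prod 𝓘(ℝ, E)) (𝓘(ℝ, ℝ).prod 𝓘(ℝ, E)).tangent ∞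
      (fun p : ℝ × M => (⟨p, suspend V p⟩ : TangentBundle (𝓘(ℝ, ℝ).prod 𝓘(ℝ, E)) (ℝ × M))) := by
  have : IsManifold 𝓘(ℝ, E) 1 M := .of_le (n := ∞) (by simp)
  have h1 : ContMDiff 𝓘(ℝ, ℝ) 𝓘(ℝ, ℝ).tangent ∞
      (fun t : ℝ => (⟨t, (1 : ℝ)⟩ : TangentBundle 𝓘(ℝ, ℝ) ℝ)) := fun t => by
    rw [Bundle.contMDiffAt_totalSpace]
    refine ⟨contMDiffAt_id, ?_⟩
    simp only [trivializationAt_model_space_apply]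
    exact contMDiffAt_const
  exact (contMDiff_equivTangentBundleProd_symm (I := 𝓘(ℝ, ℝ)) (M := ℝ) (I' := 𝓘(ℝ, E)) (M' := M)).comp
    ((h1.comp contMDiff_fst).prodMk hV)

variable [FiniteDimensional ℝ E] [T2Space M]

omit [FiniteDimensional ℝ E] in
theorem IsTrajectory.eq_of_eq (hV : IsSmoothField V) {c c' : ℝ → M} (hc : IsTrajectory V c)
    (hc' : IsTrajectory V c') {s : ℝ} (h : c s = c' s) : c = c' := by
  have : IsManifold 𝓘(ℝ, E) 1 M := .of_le (n := ∞) (by simp)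
  have h := isMIntegralCurve_Ioo_eq_of_contMDiff_boundaryless (t₀ := s)
    (hV.contMDiff_suspend.of_le (by simp)) hc.isMIntegralCurve hc'.isMIntegralCurve
    (by rw [h])
  exact funext fun t => congrArg Prod.snd (congrFun h t)

omit [T2Space M] in
theorem IsTrajectory.contMDiff (hV : IsSmoothField V) {c : ℝ → M} (hc : IsTrajectory V c) :
    ContMDiff 𝓘(ℝ, ℝ) 𝓘(ℝ, E) ∞ c := by
  have : IsManifold 𝓘(ℝ, E) 1 M := .of_le (n := ∞) (by simp)
  have := FiniteDimensional.complete ℝ E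
  exact contMDiff_snd.comp (contMDiff_integralCurve hV.contMDiff_suspend hc.isMIntegralCurve)

theorem IsTrajectory.tendsto (hV : IsSmoothField V) {ι : Type*} {l : Filter ι} {F : ι → ℝ → M}
    {c : ℝ → M} (hF : ∀ i, IsTrajectory V (F i)) (hc : IsTrajectory V c) {t₀ : ℝ}
    (h0 : Tendsto (fun i => F i t₀) l (𝓝 (c t₀))) (t : ℝ) :
    Tendsto (fun i => F i t) l (𝓝 (c t)) := by
  have : IsManifold 𝓘(ℝ, E) 1 M := .of_le (n := ∞) (by simp)
  have := FiniteDimensional.complete ℝ E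
  have h := tendsto_integralCurve (hV.contMDiff_suspend.of_le (by simp))
    (F := fun i s => (s + 0, F i s)) (l := l) (t₀ := t₀) (fun i => (hF i).isMIntegralCurve)
    hc.isMIntegralCurve (tendsto_const_nhds.prodMk_nhds h0) t
  exact (continuous_snd.tendsto _).comp h

/-- A smooth time-dependent vector field which vanishes outside a compact set, and outside a
compact time interval, is complete. -/
theorem exists_isTrajectory (hV : IsSmoothField V) {C : Set M} (hC : IsCompact C)
    (hVC : ∀ t, ∀ x ∉ C, V t x = 0) (hV0 : ∀ t ∉ Icc (0 : ℝ) 1, ∀ x, V t x = 0) (t : ℝ) (x : M) :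
    ∃ c, IsTrajectory V c ∧ c t = x := by
  have : IsManifold 𝓘(ℝ, E) 1 M := .of_le (n := ∞) (by simp)
  have := FiniteDimensional.complete ℝ E
  have hS := hV.contMDiff_suspend.of_le (m := 1) (by simp)
  -- A uniform existence time on `A`. Establishing it for the whole space suffices for completeness.
  let P : Set (ℝ × M) → Prop := fun A => ∃ ε > (0 : ℝ), ∀ p ∈ A, ∃ γ : ℝ → ℝ × M,
    γ 0 = p ∧ IsMIntegralCurveOn γ (suspend V) (Ioo (-ε) ε)
  have hmono : ∀ {ε ε' : ℝ}, ε ≤ ε' → Ioo (-ε) ε ⊆ Ioo (-ε') ε' := fun h =>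
    Ioo_subset_Ioo (neg_le_neg h) h
  have hunion : ∀ {A A' : Set (ℝ × M)}, P A → P A' → P (A ∪ A') := by
    rintro A A' ⟨ε, hε, h⟩ ⟨ε', hε', h'⟩
    refine ⟨min ε ε', lt_min hε hε', fun p hp => ?_⟩
    rcases hp with hp | hp
    · obtain ⟨γ, h0, hγ⟩ := h p hp
      exact ⟨γ, h0, hγ.mono (hmono (min_le_left _ _))⟩
    · obtain ⟨γ, h0, hγ⟩ := h' p hp
      exact ⟨γ, h0, hγ.mono (hmono (min_le_right _ _))⟩
  have hcomp : P (Icc (-1 : ℝ) 2 ×ˢ C) := by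
    refine (isCompact_Icc.prod hC).induction_on (p := P) ⟨1, one_pos, by simp⟩ ?_
      (fun _ _ => hunion) fun p _ => ?_
    · rintro A A' hA ⟨ε, hε, h⟩
      exact ⟨ε, hε, fun p hp => h p (hA hp)⟩
    · obtain ⟨W, hW, ε, hε, Φ, hΦ, -⟩ := exists_localFlow (hS p)
      exact ⟨W, mem_nhdsWithin_of_mem_nhds hW, ε, hε, fun q hq => ⟨Φ q, hΦ q hq⟩⟩
  have hconst : ∀ τ s : ℝ, ∀ y : M, V (s + τ) y = 0 →
      HasMFDerivAt 𝓘(ℝ, ℝ) (𝓘(ℝ, ℝ).prod 𝓘(ℝ, E)) (fun s : ℝ => (s + τ, y)) s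
        ((1 : ℝ →L[ℝ] ℝ).smulRight (suspend V (s + τ, y))) := fun τ s y hy => by
    refine hasMFDerivAt_suspend (c := fun _ => y) ?_
    rw [hy, ContinuousLinearMap.smulRight_zero]
    exact hasMFDerivAt_const y s
  -- The unit margin around `[0, 1]` ensures that a clock starting outside `[-1, 2]` does not enter
  -- `[0, 1]` within time 1. The stationary curve is therefore a solution.
  have hout : P (Icc (-1 : ℝ) 2 ×ˢ C)ᶜ := by
    refine ⟨1, one_pos, fun p hp => ⟨fun s => (s + p.1, p.2), by simp, fun s hs => ?_⟩⟩
    refine (hconst _ _ _ ?_).hasMFDerivWithinAt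
    by_cases hpC : p.2 ∈ C
    · refine hV0 _ (fun h => hp ⟨⟨?_, ?_⟩, hpC⟩) _
      · linarith [h.1, hs.2]
      · linarith [h.2, hs.1]
    · exact hVC _ _ hpC
  obtain ⟨ε, hε, h⟩ := hunion hcomp hout
  rw [union_compl_self] at h
  obtain ⟨γ, hγ0, hγ⟩ := exists_isMIntegralCurve_of_isMIntegralCurveOn hS hε
    (fun p => h p (mem_univ p)) (t, x)
  refine ⟨_, isTrajectory_of_isMIntegralCurve hγ, ?_⟩
  simp [hγ0]

end Trajectories

/-! ### Reparametrization and uniqueness of Hamiltonian solutions -/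

section Solutions

open Filter Topology Function

variable {E : Type*} [NormedAddCommGroup E] [NormedSpace ℝ E]
  {M : Type*} [TopologicalSpace M] [ChartedSpace E M]
  {V : ℝ → ∀ x : M, TangentSpace 𝓘(ℝ, E) x}

theorem IsSolution.mono {T T' : ℝ} {γ : ℝ → M} (hγ : IsSolution V T γ) (h : T' ≤ T) :
    IsSolution V T' γ :=
  ⟨hγ.1.mono (Icc_subset_Icc_right h), fun s hs =>
    (hγ.2 s (Icc_subset_Icc_right h hs)).mono (Icc_subset_Icc_right h)⟩

theorem IsTrajectory.isSolution {c : ℝ → M} (hc : IsTrajectory V c)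
    (hs : ContMDiff 𝓘(ℝ, ℝ) 𝓘(ℝ, E) ∞ c) (T : ℝ) : IsSolution V T c :=
  ⟨hs.contMDiffOn, fun s _ => (hc s).hasMFDerivWithinAt⟩

theorem IsSolution.congr_field {W : ℝ → ∀ x : M, TangentSpace 𝓘(ℝ, E) x} {T : ℝ} {γ : ℝ → M}
    (hγ : IsSolution V T γ) (h : ∀ s ∈ Icc 0 T, V s (γ s) = W s (γ s)) : IsSolution W T γ :=
  ⟨hγ.1, fun s hs => h s hs ▸ hγ.2 s hs⟩

theorem IsSolution.hasMFDerivWithinAt_comp {T : ℝ} {γ : ℝ → M} (hγ : IsSolution V T γ)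
    {b : ℝ → ℝ} {S : Set ℝ} {s : ℝ} (hb : DifferentiableAt ℝ b s) (hbS : MapsTo b S (Icc 0 T))
    (hs : s ∈ S) :
    HasMFDerivWithinAt 𝓘(ℝ, ℝ) 𝓘(ℝ, E) (γ ∘ b) S s
      ((1 : ℝ →L[ℝ] ℝ).smulRight (deriv b s • V (b s) (γ (b s)))) := by
  have h1 : HasMFDerivWithinAt 𝓘(ℝ, ℝ) 𝓘(ℝ, ℝ) b S s
      ((1 : ℝ →L[ℝ] ℝ).smulRight (deriv b s)) :=
    hb.hasDerivAt.hasFDerivAt.hasMFDerivAt.hasMFDerivWithinAt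
  refine ((hγ.2 (b s) (hbS hs)).comp s h1 hbS).congr_mfderiv ?_
  refine ContinuousLinearMap.ext fun r => ?_
  exact mul_smul (α := ℝ) (β := E) r (deriv b s) (V (b s) (γ (b s)))

/-- The function generating the time-reparametrized Hamiltonian flow. -/
noncomputable def reparam (b : ℝ → ℝ) (H : ℝ → M → ℝ) (s : ℝ) (x : M) : ℝ :=
  deriv b s * H (b s) x

theorem contMDiffOn_reparam {H : ℝ → M → ℝ} (hH : IsSmoothHamiltonian E H)
    {b : ℝ → ℝ} (hb : ContDiff ℝ ∞ b) {S : Set ℝ} (hbS : MapsTo b S (Icc 0 1)) :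
    ContMDiffOn (𝓘(ℝ, ℝ).prod 𝓘(ℝ, E)) 𝓘(ℝ, ℝ) ∞ (fun p : ℝ × M => reparam b H p.1 p.2)
      (S ×ˢ univ) := by
  have h1 : ContMDiff 𝓘(ℝ, ℝ) 𝓘(ℝ, ℝ) ∞ (deriv b) :=
    ((contDiff_infty_iff_deriv.1 hb).2).contMDiff
  have h2 : ContMDiffOn (𝓘(ℝ, ℝ).prod 𝓘(ℝ, E)) 𝓘(ℝ, ℝ) ∞ (fun p : ℝ × M => H (b p.1) p.2)
      (S ×ˢ univ) :=
    ContMDiffOn.comp hH (f := fun p : ℝ × M => (b p.1, p.2))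
      ((hb.contMDiff.comp contMDiff_fst).prodMk contMDiff_snd).contMDiffOn
      fun p hp => ⟨hbS hp.1, mem_univ _⟩
  exact (h1.comp contMDiff_fst).contMDiffOn.mul h2

theorem IsSmoothHamiltonian.contMDiff_slice {H : ℝ → M → ℝ} (hH : IsSmoothHamiltonian E H) {t : ℝ}
    (ht : t ∈ Icc (0 : ℝ) 1) : ContMDiff 𝓘(ℝ, E) 𝓘(ℝ, ℝ) ∞ (H t) := by
  rw [← contMDiffOn_univ]
  exact ContMDiffOn.comp hH (f := fun x : M => (t, x))
    (contMDiff_const.prodMk contMDiff_id).contMDiffOn fun x _ => ⟨ht, mem_univ x⟩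

variable [FiniteDimensional ℝ E] (Ω : SymplecticForm E M)

theorem hamVectorField_congr {f g : M → ℝ} {x : M} (h : f =ᶠ[𝓝 x] g) :
    hamVectorField Ω f x = hamVectorField Ω g x := by
  unfold hamVectorField
  rw [h.mfderiv_eq]

theorem hamVectorField_eq {f : M → ℝ} {x : M} {v : TangentSpace 𝓘(ℝ, E) x}
    (h : ∀ w, Ω.flat x v w = mfderiv 𝓘(ℝ, E) 𝓘(ℝ, ℝ) f x w) : hamVectorField Ω f x = v :=
  Ω.flat_injective x (LinearMap.ext fun w => (form_hamVectorField Ω f x w).trans (h w).symm)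

theorem hamVectorField_const_mul {f : M → ℝ} {x : M}
    (hf : MDifferentiableAt 𝓘(ℝ, E) 𝓘(ℝ, ℝ) f x) (c : ℝ) :
    hamVectorField Ω (fun y => c * f y) x = c • hamVectorField Ω f x := by
  refine hamVectorField_eq Ω fun w => ?_
  rw [map_smul, LinearMap.smul_apply, Ω.flat_apply, form_hamVectorField]
  exact (DFunLike.congr_fun (const_smul_mfderiv hf c) w).symm

theorem hamVectorField_sub_const {f : M → ℝ} {x : M}
    (hf : MDifferentiableAt 𝓘(ℝ, E) 𝓘(ℝ, ℝ) f x) (c : ℝ) :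
    hamVectorField Ω (fun y => f y - c) x = hamVectorField Ω f x := by
  refine hamVectorField_eq Ω fun w => ?_
  rw [Ω.flat_apply, form_hamVectorField]
  have h := hf.hasMFDerivAt.sub (hasMFDerivAt_const (I := 𝓘(ℝ, E)) (I' := 𝓘(ℝ, ℝ)) c x)
  refine (DFunLike.congr_fun (h.mfderiv.trans ?_) w).symm
  exact sub_zero (mfderiv 𝓘(ℝ, E) 𝓘(ℝ, ℝ) f x)

theorem hamVectorField_const (x : M) (c : ℝ) : hamVectorField Ω (fun _ => c) x = 0 := by
  refine (LinearEquiv.symm_apply_eq _).2 ?_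
  rw [map_zero, mfderiv_const]
  rfl

theorem hamField_reparam {H : ℝ → M → ℝ} (hH : IsSmoothHamiltonian E H) {b : ℝ → ℝ} {s : ℝ}
    (hs : b s ∈ Icc (0 : ℝ) 1) (x : M) :
    hamField Ω (reparam b H) s x = deriv b s • hamField Ω H (b s) x :=
  hamVectorField_const_mul Ω ((hH.contMDiff_slice hs).mdifferentiableAt (by simp)) _

variable {Ω}

/-- Since `b` takes all its values in `[0, T]`, a solution on a closed interval becomes a trajectory
for all times, to which the results on the suspension apply. -/
theorem IsSolution.isTrajectory_comp {H : ℝ → M → ℝ} (hH : IsSmoothHamiltonian E H) {T : ℝ}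
    (hT : T ≤ 1) {γ : ℝ → M} (hγ : IsSolution (hamField Ω H) T γ) {b : ℝ → ℝ}
    (hb : ContDiff ℝ ∞ b) (hbT : ∀ s, b s ∈ Icc 0 T) :
    IsTrajectory (hamField Ω (reparam b H)) (γ ∘ b) := fun s => by
  rw [hamField_reparam Ω hH (Icc_subset_Icc_right hT (hbT s))]
  exact (hγ.hasMFDerivWithinAt_comp ((hb.differentiable (by simp)) s) (fun s _ => hbT s)
    (mem_univ s)).hasMFDerivAt univ_mem

theorem IsSolution.comp {H : ℝ → M → ℝ} (hH : IsSmoothHamiltonian E H) {T T' : ℝ} (hT : T ≤ 1)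
    {γ : ℝ → M} (hγ : IsSolution (hamField Ω H) T γ) {b : ℝ → ℝ} (hb : ContDiff ℝ ∞ b)
    (hbT : MapsTo b (Icc 0 T') (Icc 0 T)) :
    IsSolution (hamField Ω (reparam b H)) T' (γ ∘ b) :=
  ⟨hγ.1.comp hb.contMDiff.contMDiffOn hbT, fun s hs => by
    rw [hamField_reparam Ω hH (Icc_subset_Icc_right hT (hbT hs))]
    exact hγ.hasMFDerivWithinAt_comp ((hb.differentiable (by simp)) s) hbT hs⟩

variable [IsManifold 𝓘(ℝ, E) ∞ M]

theorem isSmoothField_reparam {H : ℝ → M → ℝ} (hH : IsSmoothHamiltonian E H) {b : ℝ → ℝ}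
    (hb : ContDiff ℝ ∞ b) (hb1 : ∀ s, b s ∈ Icc (0 : ℝ) 1) :
    IsSmoothField (hamField Ω (reparam b H)) := by
  refine contMDiff_hamField Ω ?_
  rw [← contMDiffOn_univ, ← univ_prod_univ]
  exact contMDiffOn_reparam hH hb fun s _ => hb1 s

theorem smoothTransition_mem_Icc (s : ℝ) : Real.smoothTransition s ∈ Icc (0 : ℝ) 1 :=
  ⟨Real.smoothTransition.nonneg s, Real.smoothTransition.le_one s⟩

theorem exists_smoothTransition_eq {t : ℝ} (ht : t ∈ Icc (0 : ℝ) 1) :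
    ∃ s ∈ Icc (0 : ℝ) 1, Real.smoothTransition s = t :=
  intermediate_value_Icc zero_le_one Real.smoothTransition.continuous.continuousOn
    (by rwa [Real.smoothTransition.zero, Real.smoothTransition.one])

variable [T2Space M]

/-- Uniqueness of solutions for time-dependent Hamiltonian vector fields. -/
theorem IsSolution.eqOn {H : ℝ → M → ℝ} (hH : IsSmoothHamiltonian E H) {T : ℝ}
    (hT : T ∈ Icc (0 : ℝ) 1) {γ γ' : ℝ → M} (hγ : IsSolution (hamField Ω H) T γ)
    (hγ' : IsSolution (hamField Ω H) T γ') (h0 : γ 0 = γ' 0) : EqOn γ γ' (Icc 0 T) := by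
  have hb : ContDiff ℝ ∞ (fun s => T * Real.smoothTransition s) :=
    contDiff_const.mul Real.smoothTransition.contDiff
  have hbT (s : ℝ) : T * Real.smoothTransition s ∈ Icc 0 T :=
    ⟨mul_nonneg hT.1 (smoothTransition_mem_Icc s).1,
      mul_le_of_le_one_right hT.1 (smoothTransition_mem_Icc s).2⟩
  have heq := IsTrajectory.eq_of_eq
    (isSmoothField_reparam (Ω := Ω) hH hb fun s => Icc_subset_Icc_right hT.2 (hbT s))
    (hγ.isTrajectory_comp hH hT.2 hb hbT) (hγ'.isTrajectory_comp hH hT.2 hb hbT) (s := 0)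
    (by simp [h0])
  intro t ht
  -- Every `t` in `[0, T]` is a value of `T * Real.smoothTransition`; finding the preimage divides
  -- by `T`, so `T = 0` is separate.
  rcases hT.1.eq_or_lt with h | h
  · obtain rfl : t = 0 := le_antisymm (h ▸ ht.2) ht.1
    exact h0
  · obtain ⟨s, -, hs⟩ := exists_smoothTransition_eq
      (t := t / T) ⟨div_nonneg ht.1 h.le, (div_le_one h).2 ht.2⟩
    have := congrFun heq s
    simpa [hs, mul_div_cancel₀ t h.ne'] using this

theorem flow_eq {H : ℝ → M → ℝ} (hH : IsSmoothHamiltonian E H) {T : ℝ}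
    (hT : T ∈ Icc (0 : ℝ) 1) {γ : ℝ → M} (hγ : IsSolution (hamField Ω H) T γ) :
    flow (hamField Ω H) T (γ 0) = γ T := by
  have hex : γ 0 ∈ flowDomain (hamField Ω H) T := ⟨γ, hγ, rfl⟩
  rw [flow, dif_pos hex]
  exact hex.choose_spec.1.eqOn hH hT hγ hex.choose_spec.2 ⟨hT.1, le_rfl⟩

/-- The solutions starting on `X` exist up to time one, and their values at each time form the
set `X`. -/
def IsFlowOn (Ω : SymplecticForm E M) (H : ℝ → M → ℝ) (X : Set M) (Γ : X → ℝ → M) : Prop :=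
  (∀ x, IsSolution (hamField Ω H) 1 (Γ x) ∧ Γ x 0 = x) ∧
    ∀ t ∈ Icc (0 : ℝ) 1, range (fun x => Γ x t) = X

theorem IsFlowOn.flow_eq {H : ℝ → M → ℝ} (hH : IsSmoothHamiltonian E H) {X : Set M}
    {Γ : X → ℝ → M} (hΓ : IsFlowOn Ω H X Γ) {t : ℝ} (ht : t ∈ Icc (0 : ℝ) 1) (x : X) :
    flow (hamField Ω H) t (x : M) = Γ x t := by
  conv_lhs => rw [← (hΓ.1 x).2]
  exact HoferGeometry.flow_eq hH ht ((hΓ.1 x).1.mono ht.2)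

omit [IsManifold 𝓘(ℝ, E) ∞ M] [T2Space M] in
theorem IsFlowOn.mem {H : ℝ → M → ℝ} {X : Set M} {Γ : X → ℝ → M} (hΓ : IsFlowOn Ω H X Γ) {t : ℝ}
    (ht : t ∈ Icc (0 : ℝ) 1) (x : X) : Γ x t ∈ X := by
  have := mem_range_self (f := fun x => Γ x t) x
  rwa [hΓ.2 t ht] at this

theorem IsFlowOn.mem_compatible {H : ℝ → M → ℝ} (hH : IsSmoothHamiltonian E H) {X : Set M}
    {Γ : X → ℝ → M} (hΓ : IsFlowOn Ω H X Γ) : H ∈ compatibleHamiltonians Ω X := by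
  refine ⟨hH, fun x hx => ⟨Γ ⟨x, hx⟩, hΓ.1 ⟨x, hx⟩⟩, fun t ht => ?_⟩
  conv_rhs => rw [← hΓ.2 t ht]
  rw [image_eq_range]
  exact congrArg range (funext fun x => hΓ.flow_eq hH ht x)

/-- `flow` chooses a solution anew for each time. By uniqueness one solution on `[0, 1]` per initial
point serves all times. -/
theorem exists_isFlowOn {H : ℝ → M → ℝ} {X : Set M} (h : H ∈ compatibleHamiltonians Ω X) :
    ∃ Γ, IsFlowOn Ω H X Γ := by
  choose Γ hΓ using fun x : X => h.2.1 x.2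
  refine ⟨Γ, hΓ, fun t ht => ?_⟩
  conv_rhs => rw [← h.2.2 t ht]
  rw [image_eq_range]
  refine congrArg range (funext fun x => ?_)
  rw [← flow_eq h.1 ht ((hΓ x).1.mono ht.2), (hΓ x).2]

theorem IsFlowOn.isTimeOneMap_iff {H : ℝ → M → ℝ} (hH : IsSmoothHamiltonian E H) {X : Set M}
    {Γ : X → ℝ → M} (hΓ : IsFlowOn Ω H X Γ) {φ : X → X} :
    IsTimeOneMap Ω X H φ ↔ ∀ x, (φ x : M) = Γ x 1 :=
  forall_congr' fun x => by rw [hΓ.flow_eq hH ⟨zero_le_one, le_rfl⟩ x]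

theorem IsFlowOn.injective {H : ℝ → M → ℝ} (hH : IsSmoothHamiltonian E H) {X : Set M}
    {Γ : X → ℝ → M} (hΓ : IsFlowOn Ω H X Γ) {t : ℝ} (ht : t ∈ Icc (0 : ℝ) 1) :
    Injective (fun x => Γ x t) := by
  intro x y hxy
  obtain ⟨s, -, hs⟩ := exists_smoothTransition_eq ht
  have heq := IsTrajectory.eq_of_eq
    (isSmoothField_reparam (Ω := Ω) hH Real.smoothTransition.contDiff smoothTransition_mem_Icc)
    ((hΓ.1 x).1.isTrajectory_comp hH le_rfl Real.smoothTransition.contDiff smoothTransition_mem_Icc)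
    ((hΓ.1 y).1.isTrajectory_comp hH le_rfl Real.smoothTransition.contDiff smoothTransition_mem_Icc)
    (s := s) (by simpa [hs] using hxy)
  have h0 := congrFun heq 0
  simp only [comp_apply, Real.smoothTransition.zero, (hΓ.1 _).2] at h0
  exact Subtype.ext h0

theorem IsFlowOn.continuous {H : ℝ → M → ℝ} (hH : IsSmoothHamiltonian E H) {X : Set M}
    {Γ : X → ℝ → M} (hΓ : IsFlowOn Ω H X Γ) : Continuous (fun x => Γ x 1) := by
  refine continuous_iff_continuousAt.2 fun x₀ => ?_
  have htr (x : X) := (hΓ.1 x).1.isTrajectory_comp hH le_rfl Real.smoothTransition.contDiff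
    smoothTransition_mem_Icc
  have h := IsTrajectory.tendsto
    (isSmoothField_reparam (Ω := Ω) hH Real.smoothTransition.contDiff smoothTransition_mem_Icc)
    htr (htr x₀) (l := 𝓝 x₀) (t₀ := 0)
    (by simpa [(hΓ.1 _).2] using continuous_subtype_val.tendsto x₀) 1
  simpa [ContinuousAt] using h

end Solutions

/-! ### Oscillation and Hofer length under time changes -/

section Oscillation

variable {M : Type*} {X : Set M}

/-- This form avoids subtraction in the extended reals: bounds are checked on pairs of points, and a
change of sign only swaps the pair. -/
theorem oscOn_eq_iSup (X : Set M) (f : M → ℝ) :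
    oscOn X f = ⨆ x ∈ X, ⨆ y ∈ X, ENNReal.ofReal (f x - f y) := by
  refine le_antisymm ?_ (iSup₂_le fun x hx => iSup₂_le fun y hy => ?_)
  · by_cases htop : (⨆ x ∈ X, ⨆ y ∈ X, ENNReal.ofReal (f x - f y)) = ⊤
    · rw [htop]
      exact le_top
    obtain ⟨b, hb⟩ : ∃ b : NNReal, (b : ℝ≥0∞) = ⨆ x ∈ X, ⨆ y ∈ X, ENNReal.ofReal (f x - f y) :=
      ⟨_, ENNReal.coe_toNNReal htop⟩
    have h1 : ∀ x ∈ X, ∀ y ∈ X, f x - b ≤ f y := fun x hx y hy => by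
      have : ENNReal.ofReal (f x - f y) ≤ b := hb ▸ le_iSup₂_of_le x hx (le_iSup₂_of_le y hy le_rfl)
      rw [← ENNReal.ofReal_coe_nnreal, ENNReal.ofReal_le_ofReal_iff b.coe_nonneg] at this
      linarith
    rw [← hb, oscOn]
    have h2 : (⨆ x ∈ X, (f x : EReal)) - ⨅ x ∈ X, (f x : EReal) ≤ ((b : ℝ) : EReal) := by
      refine EReal.sub_le_of_le_add (iSup₂_le fun x hx => ?_)
      have h3 : ((f x - b : ℝ) : EReal) ≤ ⨅ x ∈ X, (f x : EReal) :=
        le_iInf₂ fun y hy => EReal.coe_le_coe_iff.2 (h1 x hx y hy)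
      rw [EReal.coe_sub] at h3
      rw [add_comm]
      exact (EReal.sub_le_iff_le_add (Or.inl (EReal.coe_ne_bot _))
        (Or.inl (EReal.coe_ne_top _))).1 h3
    refine (EReal.toENNReal_le_toENNReal h2).trans ?_
    rw [EReal.toENNReal_of_ne_top (EReal.coe_ne_top _)]
    simp
  · have h : ((f x - f y : ℝ) : EReal) ≤ (⨆ x ∈ X, (f x : EReal)) - ⨅ x ∈ X, (f x : EReal) := by
      rw [EReal.coe_sub]
      exact EReal.sub_le_sub (le_iSup₂_of_le x hx le_rfl) (iInf₂_le_of_le y hy le_rfl)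
    refine le_trans ?_ (EReal.toENNReal_le_toENNReal h)
    rw [EReal.toENNReal_of_ne_top (EReal.coe_ne_top _), EReal.toReal_coe]

theorem oscOn_const_mul (X : Set M) (f : M → ℝ) (c : ℝ) :
    oscOn X (fun x => c * f x) = ENNReal.ofReal |c| * oscOn X f := by
  simp only [oscOn_eq_iSup, ENNReal.mul_iSup, ← mul_sub]
  rcases le_total 0 c with hc | hc
  · simp only [abs_of_nonneg hc, ENNReal.ofReal_mul hc]
  · rw [iSup₂_comm]
    have h (x y : M) : c * (f y - f x) = |c| * (f x - f y) := by rw [abs_of_nonpos hc]; ring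
    simp only [h, ENNReal.ofReal_mul (abs_nonneg c)]

theorem oscOn_le {f : M → ℝ} {B : ℝ≥0∞} (h : ∀ x ∈ X, ∀ y ∈ X, ENNReal.ofReal (f x - f y) ≤ B) :
    oscOn X f ≤ B := by
  rw [oscOn_eq_iSup]
  exact iSup₂_le fun x hx => iSup₂_le fun y hy => h x hx y hy

theorem ofReal_sub_le_oscOn {f : M → ℝ} {x y : M} (hx : x ∈ X) (hy : y ∈ X) :
    ENNReal.ofReal (f x - f y) ≤ oscOn X f := by
  rw [oscOn_eq_iSup]
  exact le_iSup₂_of_le x hx (le_iSup₂_of_le y hy le_rfl)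

variable {b : ℝ → ℝ} {u w : ℝ}

/-- Substitution for a monotone `b`, which may have plateaus. The interval `[u, w]` is free so that
each half of a concatenation is covered. -/
theorem lintegral_oscOn_reparam_of_monotone (X : Set M) (H : ℝ → M → ℝ) (hb : Differentiable ℝ b)
    (hmono : Monotone b) (huw : u ≤ w) (hu : b u = 0) (hw : b w = 1) :
    ∫⁻ t in Icc u w, oscOn X (reparam b H t) = hoferLength X H := by
  have himage : b '' Icc u w = Icc 0 1 := by
    rw [hb.continuous.continuousOn.image_Icc_of_monotoneOn huw (hmono.monotoneOn _), hu, hw]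
  rw [hoferLength, ← himage, lintegral_image_eq_lintegral_deriv_mul_of_monotoneOn measurableSet_Icc
    (fun x _ => (hb x).hasDerivAt.hasDerivWithinAt) (hmono.monotoneOn _)]
  refine lintegral_congr fun t => ?_
  rw [← abs_of_nonneg (hmono.deriv_nonneg (x := t))]
  exact oscOn_const_mul X (H (b t)) (deriv b t)

theorem hoferLength_reparam_one_sub (X : Set M) (H : ℝ → M → ℝ) :
    hoferLength X (reparam (fun t => 1 - t) H) = hoferLength X H := by
  have himage : (fun t : ℝ => 1 - t) '' Icc 0 1 = Icc 0 1 := by simp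
  have hd (x : ℝ) : HasDerivAt (fun t : ℝ => 1 - t) (-1) x := (hasDerivAt_id x).const_sub 1
  conv_rhs => rw [hoferLength, ← himage, lintegral_image_eq_lintegral_abs_deriv_mul measurableSet_Icc
    (fun x _ => (hd x).hasDerivWithinAt) (fun x _ y _ h => by simpa using h)]
  refine lintegral_congr fun t => ?_
  refine (oscOn_const_mul X (H (1 - t)) (deriv (fun t => 1 - t) t)).trans ?_
  rw [(hd t).deriv]

end Oscillation

/-! ### Inversion and composition of Hamiltonian maps -/

section Group

open Filter Topology Function

variable {E : Type*} [NormedAddCommGroup E] [NormedSpace ℝ E] [FiniteDimensional ℝ E]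
  {M : Type*} [TopologicalSpace M] [ChartedSpace E M]
  {Ω : SymplecticForm E M} {X : Set M}

omit [FiniteDimensional ℝ E] in
theorem isSmoothHamiltonian_reparam {H : ℝ → M → ℝ} (hH : IsSmoothHamiltonian E H) {b : ℝ → ℝ}
    (hb : ContDiff ℝ ∞ b) (hb1 : MapsTo b (Icc 0 1) (Icc 0 1)) :
    IsSmoothHamiltonian E (reparam b H) :=
  contMDiffOn_reparam hH hb hb1

/-- The reparametrized curve starts at time `b 0` of the old one, so `σ` relabels curves by their
new initial point: the inverse map for time reversal, the identity when `b 0 = 0`. -/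
theorem IsFlowOn.reparam {H : ℝ → M → ℝ} (hH : IsSmoothHamiltonian E H) {Γ : X → ℝ → M}
    (hΓ : IsFlowOn Ω H X Γ) {b : ℝ → ℝ} (hb : ContDiff ℝ ∞ b) (hb1 : MapsTo b (Icc 0 1) (Icc 0 1))
    {σ : X → X} (hσ : Surjective σ) (hσb : ∀ x, Γ (σ x) (b 0) = x) :
    IsFlowOn Ω (reparam b H) X (fun x => Γ (σ x) ∘ b) := by
  refine ⟨fun x => ⟨(hΓ.1 (σ x)).1.comp hH le_rfl hb hb1, hσb x⟩, fun t ht => ?_⟩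
  exact (hσ.range_comp (fun x => Γ x (b t))).trans (hΓ.2 (b t) (hb1 ht))

omit [FiniteDimensional ℝ E] in
theorem isSmoothHamiltonian_zero : IsSmoothHamiltonian E (fun (_ : ℝ) (_ : M) => (0 : ℝ)) :=
  contMDiffOn_const

theorem isFlowOn_zero : IsFlowOn Ω (fun _ _ => 0) X (fun x _ => x) := by
  refine ⟨fun x => ⟨⟨contMDiffOn_const, fun s _ => ?_⟩, rfl⟩, fun t _ => Subtype.range_coe⟩
  have h : hamField Ω (fun _ _ => 0) s (x : M) = 0 := hamVectorField_const Ω (x : M) 0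
  rw [h, ContinuousLinearMap.smulRight_zero]
  exact hasMFDerivWithinAt_const (x : M) _ s

variable [IsManifold 𝓘(ℝ, E) ∞ M] [T2Space M]

theorem zero_mem_compatible : (fun _ _ => 0) ∈ compatibleHamiltonians Ω X :=
  isFlowOn_zero.mem_compatible isSmoothHamiltonian_zero

theorem isTimeOneMap_zero : IsTimeOneMap Ω X (fun _ _ => 0) id :=
  (isFlowOn_zero.isTimeOneMap_iff isSmoothHamiltonian_zero).2 fun _ => rfl

omit [TopologicalSpace M] [ChartedSpace E M] [IsManifold 𝓘(ℝ, E) ∞ M] [T2Space M] in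
theorem hoferLength_zero : hoferLength X (fun _ _ => 0) = 0 := by
  have h : oscOn X (fun _ => 0) = 0 := le_antisymm (oscOn_le fun x _ y _ => by simp) bot_le
  simp [hoferLength, h]

theorem IsTimeOneMap.bijective {H : ℝ → M → ℝ} (hH : H ∈ compatibleHamiltonians Ω X) {φ : X → X}
    (hφ : IsTimeOneMap Ω X H φ) : Bijective φ := by
  obtain ⟨Γ, hΓ⟩ := exists_isFlowOn hH
  rw [hΓ.isTimeOneMap_iff hH.1] at hφ
  have h1 : (1 : ℝ) ∈ Icc (0 : ℝ) 1 := ⟨zero_le_one, le_rfl⟩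
  refine ⟨fun x y hxy => hΓ.injective hH.1 h1 ?_, fun y => ?_⟩
  · simp only [← hφ, hxy]
  · have hy : (y : M) ∈ range (fun x => Γ x 1) := by
      rw [hΓ.2 1 h1]
      exact y.2
    obtain ⟨x, hx⟩ := hy
    exact ⟨x, Subtype.ext ((hφ x).trans hx)⟩

theorem IsTimeOneMap.continuous {H : ℝ → M → ℝ} (hH : H ∈ compatibleHamiltonians Ω X) {φ : X → X}
    (hφ : IsTimeOneMap Ω X H φ) : Continuous φ := by
  obtain ⟨Γ, hΓ⟩ := exists_isFlowOn hH
  rw [hΓ.isTimeOneMap_iff hH.1] at hφ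
  rw [continuous_induced_rng]
  have h : Subtype.val ∘ φ = fun x => Γ x 1 := funext hφ
  rw [h]
  exact hΓ.continuous hH.1

/-- Reversing time inverts the time-one map. -/
theorem isTimeOneMap_reverse {H : ℝ → M → ℝ} (hH : H ∈ compatibleHamiltonians Ω X) {φ ψ : X → X}
    (hφ : IsTimeOneMap Ω X H φ) (hψ : RightInverse ψ φ) :
    reparam (fun t => 1 - t) H ∈ compatibleHamiltonians Ω X ∧
      IsTimeOneMap Ω X (reparam (fun t => 1 - t) H) ψ := by
  obtain ⟨Γ, hΓ⟩ := exists_isFlowOn hH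
  have hbij := hφ.bijective hH
  rw [hΓ.isTimeOneMap_iff hH.1] at hφ
  have hψ' : LeftInverse ψ φ := fun x => hbij.1 (hψ (φ x))
  have hb : ContDiff ℝ ∞ (fun t : ℝ => 1 - t) := contDiff_const.sub contDiff_id
  have hb1 : MapsTo (fun t : ℝ => 1 - t) (Icc 0 1) (Icc 0 1) := fun t ht =>
    ⟨by linarith [ht.2], by linarith [ht.1]⟩
  have hrev := hΓ.reparam hH.1 hb hb1 hψ'.surjective fun x => by
    rw [sub_zero, ← hφ, hψ]
  have hsm := isSmoothHamiltonian_reparam hH.1 hb hb1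
  refine ⟨hrev.mem_compatible hsm, (hrev.isTimeOneMap_iff hsm).2 fun x => ?_⟩
  simp [(hΓ.1 _).2]

/-- Every Hamiltonian can be reparametrized by the smooth transition function. -/
theorem isTimeOneMap_smoothTransition {H : ℝ → M → ℝ} (hH : H ∈ compatibleHamiltonians Ω X)
    {φ : X → X} (hφ : IsTimeOneMap Ω X H φ) :
    reparam Real.smoothTransition H ∈ compatibleHamiltonians Ω X ∧
      IsTimeOneMap Ω X (reparam Real.smoothTransition H) φ := by
  obtain ⟨Γ, hΓ⟩ := exists_isFlowOn hH
  rw [hΓ.isTimeOneMap_iff hH.1] at hφ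
  have hb1 : MapsTo Real.smoothTransition (Icc 0 1) (Icc 0 1) := fun t _ =>
    smoothTransition_mem_Icc t
  have hrep := hΓ.reparam hH.1 Real.smoothTransition.contDiff hb1 surjective_id fun x => by
    rw [Real.smoothTransition.zero, id, (hΓ.1 x).2]
  have hsm := isSmoothHamiltonian_reparam hH.1 Real.smoothTransition.contDiff hb1
  refine ⟨hrep.mem_compatible hsm, (hrep.isTimeOneMap_iff hsm).2 fun x => ?_⟩
  simp [hφ]

omit [TopologicalSpace M] [ChartedSpace E M] [IsManifold 𝓘(ℝ, E) ∞ M] [T2Space M] in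
theorem hoferLength_reparam_smoothTransition (H : ℝ → M → ℝ) :
    hoferLength X (reparam Real.smoothTransition H) = hoferLength X H :=
  lintegral_oscOn_reparam_of_monotone X H
    ((Real.smoothTransition.contDiff (n := 1)).differentiable (by simp))
    Real.smoothTransition.monotone zero_le_one Real.smoothTransition.zero Real.smoothTransition.one

/-- The transition function completed before time `1/2`. -/
noncomputable def earlyTransition (t : ℝ) : ℝ := Real.smoothTransition (3 * t)

/-- The transition function beginning after time `1/2`. -/
noncomputable def lateTransition (t : ℝ) : ℝ := Real.smoothTransition (3 * t - 2)

theorem contDiff_earlyTransition {n : ℕ∞} : ContDiff ℝ n earlyTransition :=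
  Real.smoothTransition.contDiff.comp (contDiff_const.mul contDiff_id)

theorem contDiff_lateTransition {n : ℕ∞} : ContDiff ℝ n lateTransition :=
  Real.smoothTransition.contDiff.comp ((contDiff_const.mul contDiff_id).sub contDiff_const)

/-- Both transitions are constant on `(1/3, 2/3)`. This overlap lets functions and curves be glued
on open sets instead of at a single time. -/
theorem earlyTransition_of_gt {t : ℝ} (ht : 1 / 3 < t) : earlyTransition t = 1 :=
  Real.smoothTransition.one_of_one_le (by linarith)

theorem lateTransition_of_lt {t : ℝ} (ht : t < 2 / 3) : lateTransition t = 0 :=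
  Real.smoothTransition.zero_of_nonpos (by linarith)

theorem deriv_earlyTransition {t : ℝ} (ht : 1 / 3 < t) : deriv earlyTransition t = 0 := by
  have h : earlyTransition =ᶠ[𝓝 t] fun _ => 1 :=
    (eventually_gt_nhds ht).mono fun s hs => earlyTransition_of_gt hs
  rw [h.deriv_eq, deriv_const]

theorem deriv_lateTransition {t : ℝ} (ht : t < 2 / 3) : deriv lateTransition t = 0 := by
  have h : lateTransition =ᶠ[𝓝 t] fun _ => 0 :=
    (eventually_lt_nhds ht).mono fun s hs => lateTransition_of_lt hs
  rw [h.deriv_eq, deriv_const]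

/-- The concatenation of two time-dependent functions. -/
noncomputable def concat (H K : ℝ → M → ℝ) (t : ℝ) (x : M) : ℝ :=
  reparam earlyTransition H t x + reparam lateTransition K t x

omit [TopologicalSpace M] [ChartedSpace E M] [IsManifold 𝓘(ℝ, E) ∞ M] [T2Space M] in
theorem concat_of_lt (H K : ℝ → M → ℝ) {t : ℝ} (ht : t < 2 / 3) :
    concat H K t = reparam earlyTransition H t := by
  funext x
  simp [concat, reparam, deriv_lateTransition ht]

omit [TopologicalSpace M] [ChartedSpace E M] [IsManifold 𝓘(ℝ, E) ∞ M] [T2Space M] in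
theorem concat_of_gt (H K : ℝ → M → ℝ) {t : ℝ} (ht : 1 / 3 < t) :
    concat H K t = reparam lateTransition K t := by
  funext x
  simp [concat, reparam, deriv_earlyTransition ht]

omit [TopologicalSpace M] [ChartedSpace E M] [IsManifold 𝓘(ℝ, E) ∞ M] [T2Space M] in
theorem hoferLength_concat (H K : ℝ → M → ℝ) :
    hoferLength X (concat H K) = hoferLength X H + hoferLength X K := by
  have hunion : Icc (0 : ℝ) 1 = Icc 0 (1 / 2) ∪ Ioc (1 / 2) 1 :=
    (Icc_union_Ioc_eq_Icc (by norm_num) (by norm_num)).symm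
  have hdisj : Disjoint (Icc (0 : ℝ) (1 / 2)) (Ioc (1 / 2) 1) :=
    disjoint_left.2 fun t h1 h2 => absurd h1.2 (not_le.2 h2.1)
  conv_lhs => rw [hoferLength, hunion]
  rw [lintegral_union measurableSet_Ioc hdisj, restrict_Ioc_eq_restrict_Icc]
  congr 1
  · rw [← lintegral_oscOn_reparam_of_monotone X H (b := earlyTransition) (u := 0) (w := 1 / 2)
      ((contDiff_earlyTransition (n := 1)).differentiable (by simp))
      (fun s t hst => Real.smoothTransition.monotone (by linarith)) (by norm_num)
      (by simp [earlyTransition]) (earlyTransition_of_gt (by norm_num))]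
    exact setLIntegral_congr_fun measurableSet_Icc fun t ht => by
      rw [concat_of_lt H K (by linarith [ht.2])]
  · rw [← lintegral_oscOn_reparam_of_monotone X K (b := lateTransition) (u := 1 / 2) (w := 1)
      ((contDiff_lateTransition (n := 1)).differentiable (by simp))
      (fun s t hst => Real.smoothTransition.monotone (by linarith)) (by norm_num)
      (lateTransition_of_lt (by norm_num))
      (Real.smoothTransition.one_of_one_le (by norm_num))]
    exact setLIntegral_congr_fun measurableSet_Icc fun t ht => by
      rw [concat_of_gt H K (by linarith [ht.1])]

/-- The curve follows `H` from `x` to `φ x`, rests there, then follows `K`. Only curves starting in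
`X` are needed. -/
theorem isTimeOneMap_concat {H K : ℝ → M → ℝ} (hH : H ∈ compatibleHamiltonians Ω X)
    (hK : K ∈ compatibleHamiltonians Ω X) {φ ψ : X → X} (hφ : IsTimeOneMap Ω X H φ)
    (hψ : IsTimeOneMap Ω X K ψ) :
    concat H K ∈ compatibleHamiltonians Ω X ∧ IsTimeOneMap Ω X (concat H K) (ψ ∘ φ) := by
  obtain ⟨Γ, hΓ⟩ := exists_isFlowOn hH
  obtain ⟨Δ, hΔ⟩ := exists_isFlowOn hK
  have hsurj := (hφ.bijective hH).2
  rw [hΓ.isTimeOneMap_iff hH.1] at hφ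
  rw [hΔ.isTimeOneMap_iff hK.1] at hψ
  have ha (s : ℝ) : earlyTransition s ∈ Icc (0 : ℝ) 1 := smoothTransition_mem_Icc _
  have hb (s : ℝ) : lateTransition s ∈ Icc (0 : ℝ) 1 := smoothTransition_mem_Icc _
  have hsmooth : ContMDiff (𝓘(ℝ, ℝ).prod 𝓘(ℝ, E)) 𝓘(ℝ, ℝ) ∞
      (fun p : ℝ × M => concat H K p.1 p.2) := by
    rw [← contMDiffOn_univ, ← univ_prod_univ]
    exact (contMDiffOn_reparam hH.1 contDiff_earlyTransition fun s _ => ha s).add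
      (contMDiffOn_reparam hK.1 contDiff_lateTransition fun s _ => hb s)
  -- On `(1/3, 2/3)` both branches equal `φ x`, so the switch at `1/2` is invisible.
  let Θ : X → ℝ → M := fun x t =>
    if t < 1 / 2 then Γ x (earlyTransition t) else Δ (φ x) (lateTransition t)
  have hlt (x : X) {t : ℝ} (ht : t < 2 / 3) : Θ x t = (Γ x ∘ earlyTransition) t := by
    by_cases h : t < 1 / 2
    · exact if_pos h
    · refine (if_neg h).trans ?_
      rw [lateTransition_of_lt ht, (hΔ.1 _).2, comp_apply,
        earlyTransition_of_gt (by linarith), hφ]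
  have hgt (x : X) {t : ℝ} (ht : 1 / 3 < t) : Θ x t = (Δ (φ x) ∘ lateTransition) t := by
    by_cases h : t < 1 / 2
    · refine (if_pos h).trans ?_
      rw [earlyTransition_of_gt ht, comp_apply, lateTransition_of_lt (by linarith),
        (hΔ.1 _).2, hφ]
    · exact if_neg h
  have htraj (x : X) : IsTrajectory (hamField Ω (concat H K)) (Θ x) := fun s => by
    rcases lt_or_ge s (1 / 2) with hs | hs
    · have hs' : s < 2 / 3 := by linarith
      have h1 := (hΓ.1 x).1.isTrajectory_comp hH.1 le_rfl contDiff_earlyTransition ha s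
      have h2 : Θ x =ᶠ[𝓝 s] Γ x ∘ earlyTransition :=
        (eventually_lt_nhds hs').mono fun t ht => hlt x ht
      have h3 : hamField Ω (concat H K) s = hamField Ω (reparam earlyTransition H) s := by
        unfold hamField
        rw [concat_of_lt H K hs']
      rw [h3, hlt x hs']
      exact h1.congr_of_eventuallyEq h2
    · have hs' : 1 / 3 < s := by linarith
      have h1 := (hΔ.1 (φ x)).1.isTrajectory_comp hK.1 le_rfl contDiff_lateTransition hb s
      have h2 : Θ x =ᶠ[𝓝 s] Δ (φ x) ∘ lateTransition :=
        (eventually_gt_nhds hs').mono fun t ht => hgt x ht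
      have h3 : hamField Ω (concat H K) s = hamField Ω (reparam lateTransition K) s := by
        unfold hamField
        rw [concat_of_gt H K hs']
      rw [h3, hgt x hs']
      exact h1.congr_of_eventuallyEq h2
  have hΘ : IsFlowOn Ω (concat H K) X Θ := by
    refine ⟨fun x => ⟨(htraj x).isSolution ((htraj x).contMDiff (contMDiff_hamField Ω hsmooth)) 1,
      ?_⟩, fun t _ => ?_⟩
    · rw [hlt x (by norm_num), comp_apply, earlyTransition, mul_zero, Real.smoothTransition.zero,
        (hΓ.1 x).2]
    · rcases lt_or_ge t (1 / 2) with ht | ht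
      · exact (congrArg range (funext fun x => hlt x (by linarith))).trans (hΓ.2 _ (ha t))
      · exact (congrArg range (funext fun x => hgt x (by linarith))).trans
          ((hsurj.range_comp fun x => Δ x (lateTransition t)).trans (hΔ.2 _ (hb t)))
  have hsm : IsSmoothHamiltonian E (concat H K) := hsmooth.contMDiffOn
  refine ⟨hΘ.mem_compatible hsm, (hΘ.isTimeOneMap_iff hsm).2 fun x => ?_⟩
  rw [comp_apply, hψ, hgt x (by norm_num), comp_apply, lateTransition]
  norm_num

end Group

/-! ### The relative semi-norm and the subgroup -/

section Norm

open Filter Topology Function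

variable {E : Type*} [NormedAddCommGroup E] [NormedSpace ℝ E] [FiniteDimensional ℝ E]
  {M : Type*} [TopologicalSpace M] [ChartedSpace E M]
  {Ω : SymplecticForm E M} {X Y : Set M} {hXY : X ⊆ Y}

theorem relHoferNorm_le {φ : X → X} {ψ : Y → Y} {H : ℝ → M → ℝ}
    (hH : H ∈ compatibleHamiltonians Ω Y) (hψ : IsTimeOneMap Ω Y H ψ)
    (hφ : ∀ x : X, ψ (inclusion hXY x) = inclusion hXY (φ x)) :
    relHoferNorm Ω hXY φ ≤ hoferLength Y H :=
  iInf₂_le_of_le ψ ⟨⟨H, hH, hψ⟩, hφ⟩ (iInf₂_le H ⟨hH, hψ⟩)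

theorem le_relHoferNorm {φ : X → X} {B : ℝ≥0∞}
    (h : ∀ (ψ : Y → Y) (H : ℝ → M → ℝ), H ∈ compatibleHamiltonians Ω Y → IsTimeOneMap Ω Y H ψ →
      (∀ x : X, ψ (inclusion hXY x) = inclusion hXY (φ x)) → B ≤ hoferLength Y H) :
    B ≤ relHoferNorm Ω hXY φ :=
  le_iInf₂ fun ψ hψ => le_iInf₂ fun H hH => h ψ H hH.1 hH.2 hψ.2

variable [IsManifold 𝓘(ℝ, E) ∞ M] [T2Space M]

theorem relHoferNorm_id : relHoferNorm Ω hXY id = 0 :=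
  le_antisymm ((relHoferNorm_le zero_mem_compatible isTimeOneMap_zero fun _ => rfl).trans_eq
    hoferLength_zero) bot_le

theorem relHoferNorm_comp_le (φ φ' : X → X) :
    relHoferNorm Ω hXY (φ ∘ φ') ≤ relHoferNorm Ω hXY φ + relHoferNorm Ω hXY φ' := by
  -- Truncated subtraction moves one norm across at a time, so each infimum is bounded separately,
  -- including when it is `∞`.
  refine tsub_le_iff_left.1 (le_relHoferNorm fun ψ' H' hH' hψ' hφ' => ?_)
  refine tsub_le_iff_left.2 (tsub_le_iff_right.1 (le_relHoferNorm fun ψ H hH hψ hφ => ?_))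
  have h := isTimeOneMap_concat hH' hH hψ' hψ
  refine tsub_le_iff_right.2 ((relHoferNorm_le h.1 h.2 fun x => ?_).trans_eq
    ((hoferLength_concat H' H).trans (add_comm _ _)))
  rw [comp_apply, hφ', hφ, comp_apply]

theorem relHoferNorm_rightInverse_le {φ φ' : X → X} (h : RightInverse φ' φ) :
    relHoferNorm Ω hXY φ' ≤ relHoferNorm Ω hXY φ := by
  refine le_relHoferNorm fun ψ H hH hψ hφ => ?_
  have hbij := hψ.bijective hH
  have hinv := rightInverse_surjInv hbij.2
  have h1 := isTimeOneMap_reverse hH hψ hinv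
  refine (relHoferNorm_le h1.1 h1.2 fun x => hbij.1 ?_).trans_eq (hoferLength_reparam_one_sub Y H)
  rw [hinv, hφ, h]

variable (Ω X) in
/-- The Hamiltonian homeomorphisms of `X` as a subgroup of the homeomorphism group. -/
def hamSubgroup : Subgroup (X ≃ₜ X) where
  carrier := {g | ⇑g ∈ Ham Ω X}
  one_mem' := ⟨_, zero_mem_compatible, isTimeOneMap_zero⟩
  mul_mem' := by
    rintro g g' ⟨H, hH, hg⟩ ⟨H', hH', hg'⟩
    have h := isTimeOneMap_concat hH' hH hg' hg
    exact ⟨_, h.1, h.2⟩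
  inv_mem' := by
    rintro g ⟨H, hH, hg⟩
    have h := isTimeOneMap_reverse hH hg g.apply_symm_apply
    exact ⟨_, h.1, h.2⟩

/-- The inverse is continuous because it is itself the time-one map of the reversed Hamiltonian. -/
theorem mem_Ham_iff {φ : X → X} : φ ∈ Ham Ω X ↔ ∃ g ∈ hamSubgroup Ω X, ⇑g = φ := by
  constructor
  · rintro ⟨H, hH, hφ⟩
    have hbij := hφ.bijective hH
    have h := isTimeOneMap_reverse hH hφ (ψ := (Equiv.ofBijective φ hbij).symm)
      (Equiv.ofBijective φ hbij).apply_symm_apply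
    exact ⟨{ Equiv.ofBijective φ hbij with
      continuous_toFun := hφ.continuous hH
      continuous_invFun := h.2.continuous h.1 }, ⟨H, hH, hφ⟩, rfl⟩
  · rintro ⟨g, hg, rfl⟩
    exact hg

theorem isSemiNorm_relHoferNorm :
    IsSemiNorm (fun g : hamSubgroup Ω X => relHoferNorm Ω hXY ⇑(g : X ≃ₜ X)) where
  map_one := relHoferNorm_id
  map_inv g := le_antisymm
    (relHoferNorm_rightInverse_le (g : X ≃ₜ X).apply_symm_apply)
    (relHoferNorm_rightInverse_le (g : X ≃ₜ X).symm_apply_apply)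
  map_mul_le g h := relHoferNorm_comp_le ⇑(g : X ≃ₜ X) ⇑(h : X ≃ₜ X)

/-! ### Cutting off near a compact set -/

theorem deriv_smoothTransition_of_notMem {t : ℝ} (ht : t ∉ Icc (0 : ℝ) 1) :
    deriv Real.smoothTransition t = 0 := by
  rcases lt_or_ge t 0 with h | h
  · have h1 : Real.smoothTransition =ᶠ[𝓝 t] fun _ => 0 :=
      (eventually_lt_nhds h).mono fun s hs => Real.smoothTransition.zero_of_nonpos hs.le
    rw [h1.deriv_eq, deriv_const]
  · have h1 : Real.smoothTransition =ᶠ[𝓝 t] fun _ => 1 :=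
      (eventually_gt_nhds (lt_of_not_ge fun h' => ht ⟨h, h'⟩)).mono fun s hs =>
        Real.smoothTransition.one_of_one_le hs.le
    rw [h1.deriv_eq, deriv_const]

omit [ChartedSpace E M] [IsManifold 𝓘(ℝ, E) ∞ M] [T2Space M] in
/-- Near a compact set `Y`, the values of a continuous time-dependent function are uniformly close
to values on `Y`. -/
theorem exists_isOpen_abs_sub_lt {F : ℝ → M → ℝ} (hF : Continuous fun p : ℝ × M => F p.1 p.2)
    (hY : IsCompact Y) {ε : ℝ} (hε : 0 < ε) :
    ∃ U, IsOpen U ∧ Y ⊆ U ∧ ∀ t ∈ Icc (0 : ℝ) 1, ∀ x ∈ U, ∃ y ∈ Y, |F t x - F t y| < ε := by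
  let A : Set (ℝ × M) := ⋃ y ∈ Y, {p | |F p.1 p.2 - F p.1 y| < ε}
  have hA : IsOpen A := isOpen_biUnion fun y _ => isOpen_lt
    (hF.sub (hF.comp (continuous_fst.prodMk continuous_const))).abs continuous_const
  obtain ⟨u, U, -, hU, hu, hYU, huU⟩ := generalized_tube_lemma
    (isCompact_Icc (a := (0 : ℝ)) (b := 1)) hY hA
    (fun p hp => mem_iUnion₂.2 ⟨p.2, hp.2, by simpa using hε⟩)
  refine ⟨U, hU, hYU, fun t ht x hx => ?_⟩
  obtain ⟨y, hy, h⟩ := mem_iUnion₂.1 (huU (mk_mem_prod (hu ht) hx))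
  exact ⟨y, hy, h⟩

-- Subtracting `f y₀` makes 0 a value on `Y`. Scaling by `χ` only pulls values towards 0, so they
-- exceed the range on `Y` by at most `ε` on either side.
omit [TopologicalSpace M] [ChartedSpace E M] [IsManifold 𝓘(ℝ, E) ∞ M] [T2Space M] in
theorem oscOn_cutoff_le {f χ : M → ℝ} (hχ : ∀ x, χ x ∈ Icc (0 : ℝ) 1) {ε : ℝ} (hε : 0 ≤ ε)
    (hf : ∀ x, χ x ≠ 0 → ∃ y ∈ Y, |f x - f y| < ε) {y₀ : M} (hy₀ : y₀ ∈ Y) (Z : Set M) :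
    oscOn Z (fun x => χ x * (f x - f y₀)) ≤ oscOn Y f + ENNReal.ofReal (2 * ε) := by
  have hbound : ∀ x, (∃ y ∈ Y, χ x * (f x - f y₀) ≤ f y - f y₀ + ε) ∧
      ∃ y ∈ Y, f y - f y₀ - ε ≤ χ x * (f x - f y₀) := by
    intro x
    by_cases h0 : χ x = 0
    · exact ⟨⟨y₀, hy₀, by simpa [h0] using hε⟩, ⟨y₀, hy₀, by simpa [h0] using hε⟩⟩
    obtain ⟨y, hy, hxy⟩ := hf x h0
    have hxy' := abs_lt.1 hxy
    rcases le_total 0 (f x - f y₀) with h | h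
    · refine ⟨⟨y, hy, ?_⟩, ⟨y₀, hy₀, ?_⟩⟩
      · linarith [mul_le_of_le_one_left h (hχ x).2]
      · linarith [mul_nonneg (hχ x).1 h]
    · refine ⟨⟨y₀, hy₀, ?_⟩, ⟨y, hy, ?_⟩⟩
      · linarith [mul_nonpos_of_nonneg_of_nonpos (hχ x).1 h]
      · nlinarith [(hχ x).2]
  refine oscOn_le fun x _ z _ => ?_
  obtain ⟨y, hy, hxy⟩ := (hbound x).1
  obtain ⟨y', hy', hzy⟩ := (hbound z).2
  calc ENNReal.ofReal (χ x * (f x - f y₀) - χ z * (f z - f y₀))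
      ≤ ENNReal.ofReal (f y - f y' + 2 * ε) := ENNReal.ofReal_le_ofReal (by linarith)
    _ ≤ ENNReal.ofReal (f y - f y') + ENNReal.ofReal (2 * ε) := ENNReal.ofReal_add_le
    _ ≤ _ := by gcongr; exact ofReal_sub_le_oscOn hy hy'

/-- A smooth Hamiltonian supported in a compact subset `C` of `Y'` has a flow which is complete and
preserves `Y'`. -/
theorem exists_isFlowOn_of_compact_support {K : ℝ → M → ℝ}
    (hK : ContMDiff (𝓘(ℝ, ℝ).prod 𝓘(ℝ, E)) 𝓘(ℝ, ℝ) ∞ (fun p : ℝ × M => K p.1 p.2))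
    {C Y' : Set M} (hC : IsCompact C) (hCY' : C ⊆ Y') (hKC : ∀ t, ∀ x ∉ C, K t x = 0)
    (hK0 : ∀ t ∉ Icc (0 : ℝ) 1, ∀ x, K t x = 0) : ∃ Θ, IsFlowOn Ω K Y' Θ := by
  have hV := contMDiff_hamField Ω hK
  have hVC : ∀ t, ∀ x ∉ C, hamField Ω K t x = 0 := fun t x hx => by
    have h : K t =ᶠ[𝓝 x] fun _ => 0 :=
      (hC.isClosed.isOpen_compl.eventually_mem hx).mono fun z hz => hKC t z hz
    exact (hamVectorField_congr Ω h).trans (hamVectorField_const Ω x 0)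
  have hV0 : ∀ t ∉ Icc (0 : ℝ) 1, ∀ x, hamField Ω K t x = 0 := fun t ht x => by
    have h : K t = fun _ => 0 := funext fun z => hK0 t ht z
    rw [hamField, h]
    exact hamVectorField_const Ω x 0
  -- A trajectory that is ever outside `C` is stationary by uniqueness; otherwise it stays in `C ⊆
  -- Y'`.
  have hmaps {c : ℝ → M} (hc : IsTrajectory (hamField Ω K) c) {s s' : ℝ} (hs : c s ∈ Y') :
      c s' ∈ Y' := by
    by_cases h : c s' ∈ C
    · exact hCY' h
    have hconst : IsTrajectory (hamField Ω K) (fun _ => c s') := fun r => by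
      rw [hVC r _ h, ContinuousLinearMap.smulRight_zero]
      exact hasMFDerivAt_const (c s') r
    rwa [← congrFun (hc.eq_of_eq hV hconst (s := s') rfl) s]
  have hex := exists_isTrajectory hV hC hVC hV0
  choose Θ hΘ hΘ0 using fun x : Y' => hex 0 (x : M)
  refine ⟨Θ, fun x => ⟨(hΘ x).isSolution ((hΘ x).contMDiff hV) 1, hΘ0 x⟩, fun t _ => ?_⟩
  refine Subset.antisymm (range_subset_iff.2 fun x => hmaps (hΘ x) (s := 0) ?_) fun y hy => ?_
  · rw [hΘ0]
    exact x.2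
  -- Surjectivity: the trajectory through `y` at time `t` is followed back to time 0.
  · obtain ⟨c, hc, hcy⟩ := hex t y
    refine ⟨⟨c 0, hmaps hc (s := t) (by rwa [hcy])⟩, ?_⟩
    exact (congrFun ((hΘ _).eq_of_eq hV hc (hΘ0 _)) t).trans hcy

variable [SecondCountableTopology M]

/-- A Hamiltonian compatible with a compact set `Y` can be cut off near `Y` so that it is compatible
with a given neighbourhood of `Y`, at an arbitrarily small cost in length. -/
theorem exists_cutoff {Y' : Set M} (hYY' : Y ⊆ interior Y') (hY : IsCompact Y) (hne : Y.Nonempty)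
    {H : ℝ → M → ℝ} (hH : H ∈ compatibleHamiltonians Ω Y) {ψ : Y → Y}
    (hψ : IsTimeOneMap Ω Y H ψ) {ε : ℝ} (hε : 0 < ε) :
    ∃ K ∈ compatibleHamiltonians Ω Y', ∃ ψ' : Y' → Y', IsTimeOneMap Ω Y' K ψ' ∧
      (∀ y : Y, ψ' (inclusion (hYY'.trans interior_subset) y) =
        inclusion (hYY'.trans interior_subset) (ψ y)) ∧
      hoferLength Y' K ≤ hoferLength Y H + ENNReal.ofReal (2 * ε) := by
  have : LocallyCompactSpace M := ChartedSpace.locallyCompactSpace E M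
  obtain ⟨y₀, hy₀⟩ := hne
  -- The smooth step replaces `H`, controlled only on `[0, 1]`, by a function smooth for all times
  -- and zero outside `[0, 1]`, with the same time-one map and length.
  have hF : ContMDiff (𝓘(ℝ, ℝ).prod 𝓘(ℝ, E)) 𝓘(ℝ, ℝ) ∞
      (fun p : ℝ × M => reparam Real.smoothTransition H p.1 p.2) := by
    rw [← contMDiffOn_univ, ← univ_prod_univ]
    exact contMDiffOn_reparam hH.1 Real.smoothTransition.contDiff
      fun s _ => smoothTransition_mem_Icc s
  obtain ⟨hFc, hFψ⟩ := isTimeOneMap_smoothTransition hH hψ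
  have hFlen : hoferLength Y (reparam Real.smoothTransition H) = hoferLength Y H :=
    hoferLength_reparam_smoothTransition H
  have hF0 : ∀ t ∉ Icc (0 : ℝ) 1, ∀ x, reparam Real.smoothTransition H t x = 0 := fun t ht x => by
    rw [reparam, deriv_smoothTransition_of_notMem ht, zero_mul]
  rw [← hFlen]
  generalize reparam Real.smoothTransition H = F at *
  obtain ⟨Γ, hΓ⟩ := exists_isFlowOn hFc
  rw [hΓ.isTimeOneMap_iff hFc.1] at hFψ
  obtain ⟨U, hU, hYU, hUε⟩ := exists_isOpen_abs_sub_lt hF.continuous hY hε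
  obtain ⟨C, hC, hYC, hCU⟩ := exists_compact_between hY (hU.inter isOpen_interior)
    (subset_inter hYU hYY')
  obtain ⟨χ, hχ1, hχ0, hχ⟩ := exists_contMDiffMap_one_nhds_of_subset_interior (n := ⊤) 𝓘(ℝ, E)
    hY.isClosed hYC
  let K : ℝ → M → ℝ := fun t x => χ x * (F t x - F t y₀)
  have hK : ContMDiff (𝓘(ℝ, ℝ).prod 𝓘(ℝ, E)) 𝓘(ℝ, ℝ) ∞ (fun p : ℝ × M => K p.1 p.2) :=
    (χ.contMDiff.comp contMDiff_snd).mul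
      (hF.sub (hF.comp (contMDiff_fst.prodMk contMDiff_const)))
  have hKsm : IsSmoothHamiltonian E K := hK.contMDiffOn
  obtain ⟨Θ, hΘ⟩ := exists_isFlowOn_of_compact_support (Ω := Ω) hK hC
    (fun x hx => interior_subset (hCU hx).2)
    (fun t x hx => by simp [K, hχ0 x hx]) (fun t ht x => by simp [K, hF0 t ht])
  refine ⟨K, hΘ.mem_compatible hKsm,
    fun x => ⟨Θ x 1, hΘ.mem ⟨zero_le_one, le_rfl⟩ x⟩, (hΘ.isTimeOneMap_iff hKsm).2 fun _ => rfl,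
    fun y => Subtype.ext ?_, ?_⟩
  -- The fields depend on derivatives, so `χ = 1` is needed on a neighbourhood of `Y`. The curves `Γ
  -- y` stay in `Y`, hence also solve the equation of `K`.
  · have hfield : ∀ t ∈ Icc (0 : ℝ) 1, ∀ x ∈ Y, hamField Ω F t x = hamField Ω K t x := by
      intro t ht x hx
      have h : K t =ᶠ[𝓝 x] fun z => F t z - F t y₀ :=
        (eventually_nhdsSet_iff_forall.1 hχ1 x hx).mono fun z hz => by simp [K, hz]
      exact ((hamVectorField_congr Ω h).trans (hamVectorField_sub_const Ω
        ((hFc.1.contMDiff_slice ht).mdifferentiableAt (by simp)) _)).symm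
    have hsol : IsSolution (hamField Ω K) 1 (Γ y) :=
      (hΓ.1 y).1.congr_field fun s hs => hfield s hs _ (hΓ.mem hs y)
    have h1 := (hΘ.1 (inclusion (hYY'.trans interior_subset) y)).1.eqOn hKsm
      ⟨zero_le_one, le_rfl⟩ hsol (by rw [(hΘ.1 _).2, (hΓ.1 y).2])
      (⟨zero_le_one, le_rfl⟩ : (1 : ℝ) ∈ Icc (0 : ℝ) 1)
    exact h1.trans (hFψ y).symm
  · calc hoferLength Y' K
        ≤ ∫⁻ t in Icc (0 : ℝ) 1, (oscOn Y (F t) + ENNReal.ofReal (2 * ε)) :=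
          setLIntegral_mono' measurableSet_Icc fun t ht =>
            oscOn_cutoff_le hχ hε.le (fun x hx => hUε t ht x
              (hCU (by_contra fun h => hx (hχ0 x h))).1) hy₀ Y'
      _ = hoferLength Y F + ENNReal.ofReal (2 * ε) := by
          rw [lintegral_add_right _ measurable_const, setLIntegral_const, Real.volume_Icc]
          simp [hoferLength]

theorem relHoferNorm_le_of_subset_interior {Y' : Set M} (hYY' : Y ⊆ interior Y')
    (hY : IsCompact Y) (hne : Y.Nonempty) (φ : X → X) :
    relHoferNorm Ω (hXY.trans (hYY'.trans interior_subset)) φ ≤ relHoferNorm Ω hXY φ := by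
  refine le_relHoferNorm fun ψ H hH hψ hφ => ENNReal.le_of_forall_pos_le_add fun ε hε _ => ?_
  obtain ⟨K, hK, ψ', hψ', hres, hlen⟩ := exists_cutoff hYY' hY hne hH hψ
    (ε := ε / 2) (by positivity)
  rw [mul_div_cancel₀ _ two_ne_zero, ENNReal.ofReal_coe_nnreal] at hlen
  refine (relHoferNorm_le hK hψ' fun x => ?_).trans hlen
  exact (hres (inclusion hXY x)).trans (congrArg (inclusion (hYY'.trans interior_subset)) (hφ x))

end Norm

end HoferGeometry

theorem proposition4
    {E : Type*} [NormedAddCommGroup E] [NormedSpace ℝ E] [FiniteDimensional ℝ E]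
    {M : Type*} [TopologicalSpace M] [T2Space M] [SecondCountableTopology M]
    [ChartedSpace E M] [IsManifold 𝓘(ℝ, E) ∞ M]
    (Ω : HoferGeometry.SymplecticForm E M)
    (X Y : Set M) (hX : IsClosed X) (hY : IsClosed Y) (hXY : X ⊆ Y) :
    (∃ G : Subgroup (X ≃ₜ X),
      (∀ φ : X → X, φ ∈ HoferGeometry.Ham Ω X ↔ ∃ g ∈ G, ⇑g = φ) ∧
      HoferGeometry.IsSemiNorm
        (fun g : G => HoferGeometry.relHoferNorm Ω hXY ⇑(g : X ≃ₜ X))) ∧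
    (∀ (Y' : Set M) (_ : IsClosed Y') (hYY' : Y ⊆ interior Y'),
      IsCompact Y → Y.Nonempty →
      ∀ φ ∈ HoferGeometry.Ham Ω X,
        HoferGeometry.relHoferNorm Ω (hXY.trans (hYY'.trans interior_subset)) φ ≤
          HoferGeometry.relHoferNorm Ω hXY φ) :=
  ⟨⟨HoferGeometry.hamSubgroup Ω X, fun _ => HoferGeometry.mem_Ham_iff,
    HoferGeometry.isSemiNorm_relHoferNorm⟩,
    fun _ _ hYY' hYc hne φ _ => HoferGeometry.relHoferNorm_le_of_subset_interior hYY' hYc hne φ⟩
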